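/- Corollary 3 (out-of-distribution generalization for QNNs trained with a local cost). Setting. States of $n\ge 1$ qubits are vectors in $(\mathbb C^2)^{\otimes n}$. A law of random $n$-qubit unitaries is *locally scrambled* if it is invariant under $W\mapsto W(u_1\otimes\cdots\otimes u_n)$ for all fixed $u_1,\dots,u_n\in\mathcal U(\mathbb C^2)$. A law $\mathcal P$ of $n$-qubit states is in $\mathbb S^{(2)}_{\rm LS}$ if it is the law of $W|0\rangle^{\otimes n}$, where the law of $W$ has the same complex first and second moments $\mathbb E[W\rho W^\dagger]$ and $\mathbb E[W^{\otimes 2}\rho (W^\dagger)^{\otimes 2}]$ (for all density matrices $\rho$ on one, respectively two, copies of the $n$-qubit space) as some locally scrambled law of unitaries. An $n$-qubit unitary QNN with $T$ parameterized $k$-local gates is a family $V(\alpha)=W_0G_1(\alpha)W_1\cdots G_T(\alpha)W_T$, $\alpha$ in an arbitrary parameter set, where $W_0,\dots,W_T$ are fixed $n$-qubit unitaries and each unitary $G_t(\alpha)$ depends arbitrarily on $\alpha$ and acts non-trivially on at most $k$ qubits (which may also depend on $\alpha$). For $n$-qubit unitaries $U,V$ put $R_{\mathcal P}(U,V)=\frac14\,\mathbb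 E_{\Psi\sim\mathcal P}\big\|U|\Psi\rangle\langle\Psi|U^\dagger-V|\Psi\rangle\langle\Psi|V^\dagger\big\|_1^2$. The training inputs are $|\Psi^{(j)}\rangle=\bigotimes_{i=1}^n|\psi_i^{(j)}\rangle$, $1\le j\le N$, with independent Haar-random single-qubit states $|\psi_i^{(j)}\rangle$, and the local training cost is $$C^L_{\mathrm{Prod},N}(U,V)=1-\frac1N\sum_{j=1}^N\mathrm{Tr}\Big[|\Psi^{(j)}\rangle\langle\Psi^{(j)}|\,U^\dagger V\Big(\frac1n\sum_{i=1}^n|\psi_i^{(j)}\rangle\langle\psi_i^{(j)}|\otimes \mathbb 1_{\bar i}\Big)V^\dagger U\Big].$$ Claim. For every $k$ there is a constant $C>0$, depending only on $k$, such that for all $n\ge1$, $T\ge2$, $N\ge1$, $\delta\in(0,1)$, all $\mathcal P\in\mathbb S_{\rm LS}^{(2)}$, every $n$-qubit unitary $U$ and every $n$-qubit unitary QNN $V(\cdot)$ with $T$ parameterized $k$-local gates, with probability at least $1-\delta$ over the training data, simultaneously for every parameter $\alpha$ (in particular for the parameter $\alpha_{\rm opt}$ returned by any training procedure), $$R_{\mathcal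 P}(U,V(\alpha))\le 2n\,C^L_{\mathrm{Prod},N}(U,V(\alpha))+C\left(n\sqrt{\frac{T\log T}{N}}+\sqrt{\frac{\log(1/\delta)}{N}}\right).$$ -/

import Mathlib

open MeasureTheory Matrix
open scoped Kronecker ComplexOrder

noncomputable section

namespace QubitLearning

/-- Labels of the computational basis of `n` qubits; the state space `(ℂ²)^{⊗ n}` is
`Bits n → ℂ` and its operators are matrices indexed by `Bits n`. -/
abbrev Bits (n : ℕ) : Type := Fin n → Fin 2

/-- Unitary operators on `n` qubits. -/
abbrev UnitaryOp (n : ℕ) : Type := Matrix.unitaryGroup (Bits n) ℂ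

/-- Unitary operators on one qubit. -/
abbrev Unitary1 : Type := Matrix.unitaryGroup (Fin 2) ℂ

section Measurability

variable {ι : Type*} [Fintype ι] [DecidableEq ι]

instance instMeasurableSpaceUnitaryGroup : MeasurableSpace (Matrix.unitaryGroup ι ℂ) :=
  borel _

instance instBorelSpaceUnitaryGroup : BorelSpace (Matrix.unitaryGroup ι ℂ) := ⟨rfl⟩

instance instCompactSpaceUnitaryGroup : CompactSpace (Matrix.unitaryGroup ι ℂ) := by
  suffices h : IsCompact (Matrix.unitaryGroup ι ℂ : Set (Matrix ι ι ℂ)) from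
    isCompact_iff_compactSpace.mp h
  have hc : IsClosed (Matrix.unitaryGroup ι ℂ : Set (Matrix ι ι ℂ)) := by
    have h : (Matrix.unitaryGroup ι ℂ : Set (Matrix ι ι ℂ))
        = {A : Matrix ι ι ℂ | A * star A = 1} := by
      ext A
      exact Matrix.mem_unitaryGroup_iff
    rw [h]
    exact isClosed_eq (continuous_id.mul continuous_star) continuous_const
  have hb : IsCompact (Set.pi Set.univ fun _ : ι =>
      Set.pi Set.univ fun _ : ι => Metric.closedBall (0 : ℂ) 1) :=
    isCompact_univ_pi fun _ => isCompact_univ_pi fun _ => isCompact_closedBall _ _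
  refine IsCompact.of_isClosed_subset hb hc ?_
  intro A hA i _ j _
  simpa using entry_norm_bound_of_unitary hA i j

end Measurability

/-- Haar probability measure on the single-qubit unitary group. -/
def haarU1 : Measure Unitary1 := Measure.haarMeasure ⊤

/-! ### Tensor products -/

/-- The product vector `⊗ᵢ ψᵢ`. -/
def tensorVec {n : ℕ} (ψ : Fin n → Fin 2 → ℂ) : Bits n → ℂ :=
  fun x => ∏ i, ψ i (x i)

/-- The tensor product `⊗ᵢ Aᵢ` of single-qubit operators. -/
def tensorMat {n : ℕ} (A : Fin n → Matrix (Fin 2) (Fin 2) ℂ) : Matrix (Bits n) (Bits n) ℂ :=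
  Matrix.of fun x y => ∏ i, A i (x i) (y i)

theorem tensorMat_mul {n : ℕ} (A B : Fin n → Matrix (Fin 2) (Fin 2) ℂ) :
    tensorMat A * tensorMat B = tensorMat fun i => A i * B i := by
  ext x y
  simp only [tensorMat, Matrix.mul_apply, Matrix.of_apply, ← Finset.prod_mul_distrib]
  rw [Finset.prod_univ_sum]
  simp [Fintype.piFinset_univ]

theorem tensorMat_one {n : ℕ} :
    tensorMat (fun _ : Fin n => (1 : Matrix (Fin 2) (Fin 2) ℂ)) = 1 := by
  ext x y
  simp only [tensorMat, Matrix.of_apply, Matrix.one_apply]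
  by_cases h : x = y
  · simp [h]
  · obtain ⟨i, hi⟩ := Function.ne_iff.mp h
    rw [if_neg h]
    exact Finset.prod_eq_zero (Finset.mem_univ i) (if_neg hi)

theorem star_tensorMat {n : ℕ} (A : Fin n → Matrix (Fin 2) (Fin 2) ℂ) :
    star (tensorMat A) = tensorMat fun i => star (A i) := by
  ext x y
  simp [tensorMat, Matrix.star_apply]

/-- The tensor product `⊗ᵢ uᵢ` of single-qubit unitaries, as an `n`-qubit unitary. -/
def tensorUnitary {n : ℕ} (u : Fin n → Unitary1) : UnitaryOp n :=
  ⟨tensorMat fun i => (u i : Matrix (Fin 2) (Fin 2) ℂ), by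
    rw [Matrix.mem_unitaryGroup_iff, star_tensorMat, tensorMat_mul, ← tensorMat_one]
    congr 1
    funext i
    exact Matrix.mem_unitaryGroup_iff.mp (u i).2⟩

/-- The operator `A ⊗ 1` with the single-qubit operator `A` on qubit `i` and the identity on
all other qubits. -/
def onQubit {n : ℕ} (i : Fin n) (A : Matrix (Fin 2) (Fin 2) ℂ) : Matrix (Bits n) (Bits n) ℂ :=
  tensorMat (Function.update (fun _ => 1) i A)

/-- The operator `g ⊗ 1` with `g` on the qubits in `s` and the identity on all other qubits. -/
def onQubits {n : ℕ} (s : Finset (Fin n)) (g : Matrix (s → Fin 2) (s → Fin 2) ℂ) :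
    Matrix (Bits n) (Bits n) ℂ :=
  Matrix.of fun x y =>
    if ∀ i, i ∉ s → x i = y i then g (fun i => x i) (fun i => y i) else 0

/-- The rank-one operator `|ψ⟩⟨ψ|`. -/
def ketbra {ι : Type*} (ψ : ι → ℂ) : Matrix ι ι ℂ := Matrix.vecMulVec ψ (star ψ)

/-- The all-zero state `|0⟩^{⊗ n}`. -/
def zeroKet (n : ℕ) : Bits n → ℂ := Pi.single (fun _ => 0) 1

/-- Trace norm: the sum of the singular values. -/
def traceNorm {ι : Type*} [Fintype ι] [DecidableEq ι] (A : Matrix ι ι ℂ) : ℝ :=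
  ∑ i, Real.sqrt ((Matrix.isHermitian_conjTranspose_mul_self A).eigenvalues i)

/-! ### Ensembles -/

/-- A unitary ensemble (a law on the `n`-qubit unitaries) is locally scrambled if it is
invariant under pre-processing by tensor products of single-qubit unitaries. -/
def IsLocallyScrambled {n : ℕ} (μ : Measure (UnitaryOp n)) : Prop :=
  ∀ u : Fin n → Unitary1, μ.map (fun U => U * tensorUnitary u) = μ

/-- Density matrices. -/
def IsDensity {ι : Type*} [Fintype ι] (ρ : Matrix ι ι ℂ) : Prop :=
  ρ.PosSemidef ∧ ρ.trace = 1

/-- Equality of the complex first and second moments of two unitary ensembles. The matrix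
integrals are taken entrywise. -/
def SameMomentsTwo {n : ℕ} (μ ν : Measure (UnitaryOp n)) : Prop :=
  (∀ ρ : Matrix (Bits n) (Bits n) ℂ, IsDensity ρ → ∀ x y,
    ∫ U : UnitaryOp n, ((U : Matrix (Bits n) (Bits n) ℂ) * ρ *
        (U : Matrix (Bits n) (Bits n) ℂ)ᴴ) x y ∂μ =
      ∫ U : UnitaryOp n, ((U : Matrix (Bits n) (Bits n) ℂ) * ρ *
        (U : Matrix (Bits n) (Bits n) ℂ)ᴴ) x y ∂ν) ∧
  (∀ ρ : Matrix (Bits n × Bits n) (Bits n × Bits n) ℂ, IsDensity ρ → ∀ x y,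
    ∫ U : UnitaryOp n, (((U : Matrix (Bits n) (Bits n) ℂ) ⊗ₖ (U : Matrix (Bits n) (Bits n) ℂ)) * ρ *
        ((U : Matrix (Bits n) (Bits n) ℂ) ⊗ₖ (U : Matrix (Bits n) (Bits n) ℂ))ᴴ) x y ∂μ =
      ∫ U : UnitaryOp n, (((U : Matrix (Bits n) (Bits n) ℂ) ⊗ₖ (U : Matrix (Bits n) (Bits n) ℂ)) * ρ *
        ((U : Matrix (Bits n) (Bits n) ℂ) ⊗ₖ (U : Matrix (Bits n) (Bits n) ℂ))ᴴ) x y ∂ν)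

/-- A unitary ensemble is locally scrambled up to complex second moments if its first and
second moments agree with those of some locally scrambled ensemble. -/
def IsLocallyScrambledTwo {n : ℕ} (μ : Measure (UnitaryOp n)) : Prop :=
  IsProbabilityMeasure μ ∧ ∃ ν : Measure (UnitaryOp n),
    IsProbabilityMeasure ν ∧ IsLocallyScrambled ν ∧ SameMomentsTwo μ ν

/-- A state ensemble (a law of random state vectors) is locally scrambled up to complex second
moments if it is the law of `U |0⟩^{⊗ n}` for such a unitary ensemble. -/
def IsLocallyScrambledStatesTwo {n : ℕ} (P : Measure (Bits n → ℂ)) : Prop :=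
  ∃ μ : Measure (UnitaryOp n), IsLocallyScrambledTwo μ ∧
    P = μ.map (fun U : UnitaryOp n => (U : Matrix (Bits n) (Bits n) ℂ) *ᵥ zeroKet n)

/-- The law of a Haar-random single-qubit state `u |0⟩`. -/
def haarState1 : Measure (Fin 2 → ℂ) :=
  haarU1.map (fun u : Unitary1 => (u : Matrix (Fin 2) (Fin 2) ℂ) *ᵥ Pi.single 0 1)

/-- The law of `N` independent product inputs `⊗ᵢ ψᵢ⁽ʲ⁾`, recorded through their independent
Haar-random single-qubit factors: `D j i` is `ψᵢ⁽ʲ⁾`. -/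
def productDataLaw (n N : ℕ) : Measure (Fin N → Fin n → Fin 2 → ℂ) :=
  Measure.pi fun _ : Fin N => Measure.pi fun _ : Fin n => haarState1

/-! ### Quantum neural networks -/

/-- `G` acts non-trivially on at most `k` qubits. -/
def IsLocalGate {n : ℕ} (k : ℕ) (G : UnitaryOp n) : Prop :=
  ∃ (s : Finset (Fin n)) (g : Matrix.unitaryGroup (s → Fin 2) ℂ), s.card ≤ k ∧
    (G : Matrix (Bits n) (Bits n) ℂ) = onQubits s (g : Matrix (s → Fin 2) (s → Fin 2) ℂ)

/-- An `n`-qubit unitary QNN with parameter set `A` and `T` parameterized `k`-local gates: a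
circuit in which the `t`-th tunable gate `gate t α` depends in an arbitrary way on the parameter
(also through the set of at most `k` qubits it acts on), while everything between the tunable
gates does not depend on the parameter. -/
structure QNN (n k T : ℕ) (A : Type*) where
  fixed : Fin (T + 1) → UnitaryOp n
  gate : Fin T → A → UnitaryOp n
  gate_local : ∀ t α, IsLocalGate k (gate t α)

/-- The unitary `V(α) = W₀ G₀(α) W₁ G₁(α) W₂ ⋯ G_{T-1}(α) W_T` implemented by the QNN. -/
def QNN.unitary {n k T : ℕ} {A : Type*} (V : QNN n k T A) (α : A) : UnitaryOp n :=
  V.fixed 0 * (List.ofFn fun t : Fin T => V.gate t α * V.fixed t.succ).prod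

/-! ### Risk and cost -/

/-- The expected risk `R_P(U, V)`. -/
def risk {n : ℕ} (P : Measure (Bits n → ℂ)) (U V : UnitaryOp n) : ℝ :=
  (1 / 4) * ∫ ψ, traceNorm
    ((U : Matrix (Bits n) (Bits n) ℂ) * ketbra ψ * (U : Matrix (Bits n) (Bits n) ℂ)ᴴ -
      (V : Matrix (Bits n) (Bits n) ℂ) * ketbra ψ * (V : Matrix (Bits n) (Bits n) ℂ)ᴴ) ^ 2 ∂P

/-- The local measurement operator `(1/n) ∑ᵢ |ψᵢ⟩⟨ψᵢ| ⊗ 1`. -/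
def localH {n : ℕ} (ψ : Fin n → Fin 2 → ℂ) : Matrix (Bits n) (Bits n) ℂ :=
  (1 / n : ℂ) • ∑ i, onQubit i (ketbra (ψ i))

/-- The local training cost on the product training inputs `D`. The trace is a real number. -/
def localCost {n N : ℕ} (D : Fin N → Fin n → Fin 2 → ℂ) (U V : UnitaryOp n) : ℝ :=
  1 - (1 / N) * ∑ j, (Matrix.trace
    (ketbra (tensorVec (D j)) * (U : Matrix (Bits n) (Bits n) ℂ)ᴴ *
      (V : Matrix (Bits n) (Bits n) ℂ) * localH (D j) *
      (V : Matrix (Bits n) (Bits n) ℂ)ᴴ * (U : Matrix (Bits n) (Bits n) ℂ))).re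

end QubitLearning

end

open QubitLearning

/-!
Write `M = U† V` and `d = 2ⁿ`. The risk of a pair of pure states is at most their infidelity
`1 - |⟨ψ|M|ψ⟩|²` (`traceNorm_ketbra_sub_ketbra_sq_le`), a polynomial that only involves second
moments of the ensemble. Averaging a locally scrambled ensemble over products of bit flips and
applying the Cauchy-Schwarz inequality shows that the risk is at most `1 - |Tr M|² / d²`
(`risk_le_one_sub_trace`). For Haar-random product states, the Pauli expansion of `|⟨ψ|M|ψ⟩|²` is
diagonal in expectation, with the weight `3⁻ʷ` for a Pauli string of weight `w`; since the squared
Pauli coefficients sum to one, the expected infidelity is at least `(2/3) (1 - |Tr M|² / d²)`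
(`integral_overlap_le`). Hence the risk is at most twice the expected infidelity on product states.

It remains to compare this expectation with the training cost. Sample by sample, the global
infidelity is at most `n` times the local loss, by a union bound in the product basis of the sample
(`one_sub_overlap_le_local`). So it suffices to bound the deviations of the global infidelity,
which takes values in `[0, 1]`; that is why the confidence term carries no factor `n`.

These deviations are bounded uniformly in the parameter (`le_measure_forall_deviation_overlap_le`).
The gates are discretized on a grid, one circuit is chosen for every discretized circuit that
occurs, and Hoeffding's inequality is applied to these representatives and to the `16ⁿ` products
of Bloch coordinates in which `|⟨ψ|M|ψ⟩|²` is linear. The latter control the discretization error: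
it is the fluctuation of an explicit linear combination with small coefficients, so a mesh of order
`1 / (T 256ⁿ)` that does not depend on the sample size suffices. The number of discretized circuits
is then `exp (O_k (n T log T))` (`card_label_add_le`), with no logarithm of the sample size, and no
chaining is needed.
-/

noncomputable section

namespace QubitLearning

/-! ### Pauli expansion of the overlap with a product state -/

/-- The Pauli matrices `1, X, Y, Z`, indexed by `Fin 4`. -/
def pauli : Fin 4 → Matrix (Fin 2) (Fin 2) ℂ :=
  ![1, !![0, 1; 1, 0], !![0, -Complex.I; Complex.I, 0], !![1, 0; 0, -1]]

/-- The Bloch coordinates `⟨ψ|σ_a|ψ⟩` of a one-qubit vector, including the coordinate `⟨ψ|ψ⟩` at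
index `0`. -/
def bloch (ψ : Fin 2 → ℂ) : Fin 4 → ℝ :=
  ![Complex.normSq (ψ 0) + Complex.normSq (ψ 1),
    2 * ((ψ 0).re * (ψ 1).re + (ψ 0).im * (ψ 1).im),
    2 * ((ψ 0).re * (ψ 1).im - (ψ 0).im * (ψ 1).re),
    Complex.normSq (ψ 0) - Complex.normSq (ψ 1)]

theorem mul_star_eq_sum_pauli (ψ : Fin 2 → ℂ) (x y : Fin 2) :
    ψ x * star (ψ y) = ∑ a, (bloch ψ a / 2 : ℂ) * pauli a x y := by
  fin_cases x <;> fin_cases y <;> apply Complex.ext <;>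
    simp [Fin.sum_univ_four, pauli, bloch, Complex.normSq_apply] <;> ring

theorem sum_pauli_mul_star (x y x' y' : Fin 2) :
    ∑ a, pauli a x y * star (pauli a x' y') = if x = x' ∧ y = y' then 2 else 0 := by
  fin_cases x <;> fin_cases y <;> fin_cases x' <;> fin_cases y' <;>
    simp [Fin.sum_univ_four, pauli] <;> norm_num

theorem norm_pauli_le_one (a : Fin 4) (x y : Fin 2) : ‖pauli a x y‖ ≤ 1 := by
  fin_cases a <;> fin_cases x <;> fin_cases y <;> simp [pauli]

/-- The matrix entry `⟨x|σ_P|y⟩` of the Pauli string `P`. -/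
def pauliString {n : ℕ} (P : Fin n → Fin 4) (x y : Bits n) : ℂ := ∏ i, pauli (P i) (x i) (y i)

/-- The Bloch coordinate `⟨Ψ|σ_P|Ψ⟩` of the product state `Ψ = ⊗ᵢ ψᵢ`. -/
def blochString {n : ℕ} (P : Fin n → Fin 4) (ψ : Fin n → Fin 2 → ℂ) : ℝ := ∏ i, bloch (ψ i) (P i)

/-- The Pauli coefficient `Tr (M σ_P)`, without normalization. -/
def pauliCoeff {n : ℕ} (M : Matrix (Bits n) (Bits n) ℂ) (P : Fin n → Fin 4) : ℂ :=
  ∑ x, ∑ y, M x y * pauliString P y x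

/-- The matrix element `⟨ψ|M|ψ⟩`. -/
def expect {ι : Type*} [Fintype ι] (M : Matrix ι ι ℂ) (ψ : ι → ℂ) : ℂ :=
  star ψ ⬝ᵥ M *ᵥ ψ

theorem expect_eq_sum {ι : Type*} [Fintype ι] (M : Matrix ι ι ℂ) (ψ : ι → ℂ) :
    expect M ψ = ∑ x, ∑ y, M x y * (ψ y * star (ψ x)) := by
  simp only [expect, dotProduct, mulVec, Finset.mul_sum, Pi.star_apply]
  refine Finset.sum_congr rfl fun x _ => Finset.sum_congr rfl fun y _ => by ring

theorem tensorVec_mul_star {n : ℕ} (ψ : Fin n → Fin 2 → ℂ) (x y : Bits n) :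
    tensorVec ψ x * star (tensorVec ψ y) =
      ∑ P : Fin n → Fin 4, (1 / 2 : ℂ) ^ n * blochString P ψ * pauliString P x y := by
  simp only [tensorVec, star_prod, ← Finset.prod_mul_distrib, mul_star_eq_sum_pauli]
  rw [Fintype.prod_sum]
  refine Finset.sum_congr rfl fun P _ => ?_
  simp only [blochString, pauliString, Complex.ofReal_prod, Finset.prod_mul_distrib,
    Finset.prod_div_distrib]
  rw [Finset.prod_const, Finset.card_univ, Fintype.card_fin, one_div, inv_pow]
  ring

theorem expect_tensorVec {n : ℕ} (M : Matrix (Bits n) (Bits n) ℂ) (ψ : Fin n → Fin 2 → ℂ) :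
    expect M (tensorVec ψ) = (1 / 2 : ℂ) ^ n * ∑ P, blochString P ψ * pauliCoeff M P := by
  simp only [expect_eq_sum, tensorVec_mul_star, pauliCoeff, Finset.mul_sum]
  calc _ = ∑ x, ∑ P : Fin n → Fin 4, ∑ y, M x y *
        ((1 / 2 : ℂ) ^ n * blochString P ψ * pauliString P y x) :=
        Finset.sum_congr rfl fun x _ => Finset.sum_comm
    _ = _ := by
      rw [Finset.sum_comm]
      refine Finset.sum_congr rfl fun P _ => Finset.sum_congr rfl fun x _ =>
        Finset.sum_congr rfl fun y _ => by ring

/-- The coefficient of `h_P h_Q` in the expansion of `|⟨Ψ|M|Ψ⟩|²`, where `h_P` are the Bloch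
coordinates of the product state `Ψ`. -/
def overlapCoeff {n : ℕ} (M : Matrix (Bits n) (Bits n) ℂ) (P Q : Fin n → Fin 4) : ℝ :=
  (1 / 4) ^ n * (pauliCoeff M P * star (pauliCoeff M Q)).re

theorem normSq_expect_tensorVec {n : ℕ} (M : Matrix (Bits n) (Bits n) ℂ)
    (ψ : Fin n → Fin 2 → ℂ) :
    Complex.normSq (expect M (tensorVec ψ)) =
      ∑ P, ∑ Q, overlapCoeff M P Q * (blochString P ψ * blochString Q ψ) := by
  have h : (Complex.normSq (expect M (tensorVec ψ)) : ℂ) =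
      ∑ P, ∑ Q, ((1 / 4) ^ n * (pauliCoeff M P * star (pauliCoeff M Q))) *
        (blochString P ψ * blochString Q ψ) := by
    rw [← Complex.mul_conj, expect_tensorVec]
    have h4 : (1 / 4 : ℂ) ^ n = (1 / 2) ^ n * (1 / 2) ^ n := by
      rw [← mul_pow]; norm_num
    simp only [map_mul, map_pow, map_sum, Complex.conj_ofReal, map_div₀, map_one, map_ofNat]
    rw [mul_mul_mul_comm, ← h4, Finset.sum_mul_sum, Finset.mul_sum]
    refine Finset.sum_congr rfl fun P _ => ?_
    rw [Finset.mul_sum]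
    refine Finset.sum_congr rfl fun Q _ => ?_
    simp only [← starRingEnd_apply]
    ring
  have h' := congrArg Complex.re h
  rw [Complex.ofReal_re] at h'
  rw [h']
  simp only [Complex.re_sum, overlapCoeff]
  refine Finset.sum_congr rfl fun P _ => Finset.sum_congr rfl fun Q _ => ?_
  rw [← Complex.ofReal_mul, Complex.re_mul_ofReal]
  congr 1
  have : ((1 / 4 : ℂ) ^ n) = (((1 / 4 : ℝ) ^ n : ℝ) : ℂ) := by push_cast; ring
  rw [this, Complex.re_ofReal_mul]

theorem sum_pauliString_mul_star {n : ℕ} (x y x' y' : Bits n) :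
    ∑ P, pauliString P x y * star (pauliString P x' y') =
      if x = x' ∧ y = y' then 2 ^ n else 0 := by
  simp only [pauliString, star_prod, ← Finset.prod_mul_distrib]
  rw [← Fintype.prod_sum (fun (i : Fin n) (a : Fin 4) =>
    pauli a (x i) (y i) * star (pauli a (x' i) (y' i)))]
  simp only [sum_pauli_mul_star]
  split_ifs with h
  · simp [h.1, h.2]
  · rw [not_and_or] at h
    rcases h with h | h <;> obtain ⟨i, hi⟩ := Function.ne_iff.mp h <;>
      exact Finset.prod_eq_zero (Finset.mem_univ i) (by simp [hi])

/-- Parseval's identity for the Pauli basis. -/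
theorem sum_normSq_pauliCoeff {n : ℕ} (M : Matrix (Bits n) (Bits n) ℂ) :
    ∑ P, Complex.normSq (pauliCoeff M P) = 2 ^ n * ∑ x, ∑ y, Complex.normSq (M x y) := by
  have h : ((∑ P, Complex.normSq (pauliCoeff M P) : ℝ) : ℂ) =
      ((2 ^ n * ∑ x, ∑ y, Complex.normSq (M x y) : ℝ) : ℂ) := by
    push_cast
    calc ∑ P, (Complex.normSq (pauliCoeff M P) : ℂ)
        = ∑ P, ∑ u : Bits n × Bits n, ∑ v : Bits n × Bits n, (M u.1 u.2 * star (M v.1 v.2)) *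
            (pauliString P u.2 u.1 * star (pauliString P v.2 v.1)) := by
          refine Finset.sum_congr rfl fun P _ => ?_
          rw [← Complex.mul_conj, pauliCoeff, ← Fintype.sum_prod_type', map_sum,
            Finset.sum_mul_sum]
          refine Finset.sum_congr rfl fun u _ => Finset.sum_congr rfl fun v _ => ?_
          simp only [map_mul, ← starRingEnd_apply]
          ring
      _ = ∑ u : Bits n × Bits n, ∑ v : Bits n × Bits n, (M u.1 u.2 * star (M v.1 v.2)) *
            ∑ P, (pauliString P u.2 u.1 * star (pauliString P v.2 v.1)) := by
          rw [Finset.sum_comm]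
          refine Finset.sum_congr rfl fun u _ => ?_
          rw [Finset.sum_comm]
          simp only [Finset.mul_sum]
      _ = ∑ u : Bits n × Bits n, ∑ v : Bits n × Bits n,
            if v = u then (M u.1 u.2 * star (M u.1 u.2)) * 2 ^ n else 0 := by
          refine Finset.sum_congr rfl fun u _ => Finset.sum_congr rfl fun v _ => ?_
          rw [sum_pauliString_mul_star]
          by_cases huv : v = u
          · simp [huv]
          · rw [if_neg huv, if_neg, mul_zero]
            rintro ⟨h1, h2⟩
            exact huv (Prod.ext h2.symm h1.symm)
      _ = _ := by
          simp only [Finset.sum_ite_eq', Finset.mem_univ, if_true]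
          rw [Fintype.sum_prod_type, Finset.mul_sum]
          refine Finset.sum_congr rfl fun x _ => ?_
          rw [Finset.mul_sum]
          refine Finset.sum_congr rfl fun y _ => ?_
          rw [← Complex.mul_conj, starRingEnd_apply]
          ring
  exact_mod_cast h

theorem sum_normSq_unitary {n : ℕ} (M : UnitaryOp n) (x : Bits n) :
    ∑ y, Complex.normSq ((M : Matrix (Bits n) (Bits n) ℂ) x y) = 1 := by
  have h := congrFun (congrFun (Matrix.mem_unitaryGroup_iff.mp M.2) x) x
  rw [Matrix.mul_apply, Matrix.one_apply_eq] at h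
  have h' : ((∑ y, Complex.normSq ((M : Matrix (Bits n) (Bits n) ℂ) x y) : ℝ) : ℂ) = 1 := by
    rw [← h]
    push_cast
    refine Finset.sum_congr rfl fun y _ => ?_
    rw [← Complex.mul_conj, Matrix.star_apply, starRingEnd_apply]
  exact_mod_cast h'

theorem sum_normSq_pauliCoeff_unitary {n : ℕ} (M : UnitaryOp n) :
    ∑ P, Complex.normSq (pauliCoeff (M : Matrix (Bits n) (Bits n) ℂ) P) = 4 ^ n := by
  rw [sum_normSq_pauliCoeff]
  simp only [sum_normSq_unitary]
  simp [← mul_pow]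
  norm_num

theorem pauliString_zero {n : ℕ} (x y : Bits n) :
    pauliString (0 : Fin n → Fin 4) x y = if x = y then 1 else 0 := by
  simp only [pauliString, Pi.zero_apply, pauli]
  have := congrFun (congrFun (tensorMat_one (n := n)) x) y
  simpa [tensorMat, Matrix.one_apply] using this

theorem pauliCoeff_zero {n : ℕ} (M : Matrix (Bits n) (Bits n) ℂ) :
    pauliCoeff M 0 = M.trace := by
  simp [pauliCoeff, pauliString_zero, Matrix.trace]

/-! ### Second moments of Haar-random product states -/

instance : IsProbabilityMeasure haarU1 :=
  ⟨by simpa [haarU1] using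
    Measure.haarMeasure_self (K₀ := (⊤ : TopologicalSpace.PositiveCompacts Unitary1))⟩

instance : haarU1.IsMulLeftInvariant := by unfold haarU1; infer_instance

theorem continuous_unitary_mulVec {ι : Type*} [Fintype ι] [DecidableEq ι] (v : ι → ℂ) :
    Continuous fun u : Matrix.unitaryGroup ι ℂ => (u : Matrix ι ι ℂ) *ᵥ v :=
  continuous_subtype_val.matrix_mulVec continuous_const

instance : IsProbabilityMeasure haarState1 :=
  Measure.isProbabilityMeasure_map (continuous_unitary_mulVec _).measurable.aemeasurable

theorem integral_haarState1_mulVec (g : Unitary1) {φ : (Fin 2 → ℂ) → ℝ} (hφ : Continuous φ) :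
    ∫ ψ, φ ((g : Matrix (Fin 2) (Fin 2) ℂ) *ᵥ ψ) ∂haarState1 = ∫ ψ, φ ψ ∂haarState1 := by
  have hm := (continuous_unitary_mulVec (ι := Fin 2) (Pi.single 0 1)).measurable.aemeasurable
    (μ := haarU1)
  have hg : Continuous fun ψ : Fin 2 → ℂ => φ ((g : Matrix (Fin 2) (Fin 2) ℂ) *ᵥ ψ) :=
    hφ.comp (continuous_const.matrix_mulVec continuous_id)
  rw [haarState1, integral_map hm hg.aestronglyMeasurable,
    integral_map hm hφ.aestronglyMeasurable]
  rw [← integral_mul_left_eq_self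
    (fun u : Unitary1 => φ ((u : Matrix (Fin 2) (Fin 2) ℂ) *ᵥ Pi.single 0 1)) g]
  simp only [Matrix.mulVec_mulVec, Submonoid.coe_mul]

theorem ae_haarState1_bloch_zero : ∀ᵐ ψ ∂haarState1, bloch ψ 0 = 1 := by
  have hm := (continuous_unitary_mulVec (ι := Fin 2) (Pi.single 0 1)).measurable.aemeasurable
    (μ := haarU1)
  have hs : MeasurableSet {ψ : Fin 2 → ℂ | bloch ψ 0 = 1} := by
    refine (isClosed_eq ?_ continuous_const).measurableSet
    simp only [bloch, Complex.normSq_apply, cons_val_zero]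
    fun_prop
  rw [haarState1, ae_map_iff hm hs]
  refine Filter.Eventually.of_forall fun u => ?_
  have h := congrFun (congrFun (Matrix.mem_unitaryGroup_iff'.mp u.2) 0) 0
  have h' := congrArg Complex.re h
  simpa [bloch, Matrix.mul_apply, Fin.sum_univ_two, Matrix.star_apply, Complex.normSq_apply]
    using h'

theorem sum_bloch_sq (ψ : Fin 2 → ℂ) :
    bloch ψ 1 ^ 2 + bloch ψ 2 ^ 2 + bloch ψ 3 ^ 2 = bloch ψ 0 ^ 2 := by
  simp [bloch, Complex.normSq_apply]; ring

theorem abs_bloch_le_one {ψ : Fin 2 → ℂ} (h : bloch ψ 0 = 1) (a : Fin 4) : |bloch ψ a| ≤ 1 := by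
  have h2 := sum_bloch_sq ψ
  rw [h] at h2
  rw [← sq_le_one_iff_abs_le_one]
  have h0 : bloch ψ 0 ^ 2 ≤ 1 := by rw [h]; norm_num
  have h1 : bloch ψ 1 ^ 2 ≤ 1 := by nlinarith [sq_nonneg (bloch ψ 2), sq_nonneg (bloch ψ 3)]
  have h3 : bloch ψ 2 ^ 2 ≤ 1 := by nlinarith [sq_nonneg (bloch ψ 1), sq_nonneg (bloch ψ 3)]
  have h4 : bloch ψ 3 ^ 2 ≤ 1 := by nlinarith [sq_nonneg (bloch ψ 1), sq_nonneg (bloch ψ 2)]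
  fin_cases a <;> assumption

theorem continuous_bloch (a : Fin 4) : Continuous fun ψ => bloch ψ a := by
  fin_cases a <;> simp [bloch, Complex.normSq_apply] <;> fun_prop

/-- The Pauli matrix `X` as a unitary. -/
def unitaryX : Unitary1 := ⟨!![0, 1; 1, 0], by
  rw [Matrix.mem_unitaryGroup_iff]
  ext i j; fin_cases i <;> fin_cases j <;> simp [Matrix.mul_apply, Fin.sum_univ_two]⟩

/-- The Pauli matrix `Z` as a unitary. -/
def unitaryZ : Unitary1 := ⟨!![1, 0; 0, -1], by
  rw [Matrix.mem_unitaryGroup_iff]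
  ext i j; fin_cases i <;> fin_cases j <;> simp [Matrix.mul_apply, Fin.sum_univ_two]⟩

/-- The phase gate `S = diag(1, i)`. -/
def unitaryS : Unitary1 := ⟨!![1, 0; 0, Complex.I], by
  rw [Matrix.mem_unitaryGroup_iff]
  ext i j; fin_cases i <;> fin_cases j <;> simp [Matrix.mul_apply, Fin.sum_univ_two]⟩

/-- The Hadamard gate. -/
def unitaryH : Unitary1 := ⟨!![(√2 / 2 : ℝ), (√2 / 2 : ℝ); (√2 / 2 : ℝ), (-(√2 / 2) : ℝ)], by
  have h : (√2 / 2 : ℝ) * (√2 / 2) = 1 / 2 := by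
    rw [div_mul_div_comm, Real.mul_self_sqrt (by norm_num)]; norm_num
  have h' : ((√2 / 2 : ℝ) : ℂ) * ((√2 / 2 : ℝ) : ℂ) = 1 / 2 := by
    rw [← Complex.ofReal_mul, h]; norm_num
  rw [Matrix.mem_unitaryGroup_iff]
  ext i j
  fin_cases i <;> fin_cases j <;>
    simp only [Matrix.mul_apply, Fin.sum_univ_two, Matrix.star_apply, Matrix.of_apply,
      Complex.star_def, Complex.conj_ofReal, Complex.ofReal_neg, map_neg, Fin.zero_eta, Fin.mk_one,
      Fin.isValue, cons_val', cons_val_zero, cons_val_one, cons_val_fin_one, mul_neg,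
      neg_mul, neg_neg, h'] <;>
    norm_num⟩

theorem bloch_unitaryX (ψ : Fin 2 → ℂ) :
    bloch ((unitaryX : Matrix (Fin 2) (Fin 2) ℂ) *ᵥ ψ) =
      ![bloch ψ 0, bloch ψ 1, -bloch ψ 2, -bloch ψ 3] := by
  ext a
  fin_cases a <;> simp [bloch, unitaryX, Complex.normSq_apply, mulVec, dotProduct, Fin.sum_univ_two]
    <;> ring

theorem bloch_unitaryZ (ψ : Fin 2 → ℂ) :
    bloch ((unitaryZ : Matrix (Fin 2) (Fin 2) ℂ) *ᵥ ψ) =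
      ![bloch ψ 0, -bloch ψ 1, -bloch ψ 2, bloch ψ 3] := by
  ext a
  fin_cases a <;> simp [bloch, unitaryZ, Complex.normSq_apply, mulVec, dotProduct, Fin.sum_univ_two]
    <;> ring

theorem bloch_unitaryS (ψ : Fin 2 → ℂ) :
    bloch ((unitaryS : Matrix (Fin 2) (Fin 2) ℂ) *ᵥ ψ) =
      ![bloch ψ 0, -bloch ψ 2, bloch ψ 1, bloch ψ 3] := by
  ext a
  fin_cases a <;> simp [bloch, unitaryS, Complex.normSq_apply, mulVec, dotProduct, Fin.sum_univ_two]
    <;> ring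

theorem bloch_unitaryH (ψ : Fin 2 → ℂ) :
    bloch ((unitaryH : Matrix (Fin 2) (Fin 2) ℂ) *ᵥ ψ) =
      ![bloch ψ 0, bloch ψ 3, -bloch ψ 2, bloch ψ 1] := by
  have h : (√2 : ℝ) ^ 2 = 2 := Real.sq_sqrt (by norm_num)
  ext a
  fin_cases a <;> simp [bloch, unitaryH, Complex.normSq_apply, mulVec, dotProduct, Fin.sum_univ_two]
    <;> ring_nf <;> rw [h] <;> ring

theorem integrable_haarState1 (a b : Fin 4) :
    Integrable (fun ψ => bloch ψ a * bloch ψ b) haarState1 := by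
  refine Integrable.of_mem_Icc (-1) 1
    ((continuous_bloch a).mul (continuous_bloch b)).measurable.aemeasurable ?_
  filter_upwards [ae_haarState1_bloch_zero] with ψ hψ
  rw [Set.mem_Icc, ← abs_le, abs_mul]
  exact mul_le_one₀ (abs_bloch_le_one hψ a) (abs_nonneg _) (abs_bloch_le_one hψ b)

/-- The Bloch vector of a Haar-random one-qubit state is isotropic. -/
theorem integral_bloch_mul_bloch (a b : Fin 4) :
    ∫ ψ, bloch ψ a * bloch ψ b ∂haarState1 =
      if a = b then (if a = 0 then 1 else 1 / 3) else 0 := by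
  have key (g : Unitary1) (a b : Fin 4) := integral_haarState1_mulVec g
    (φ := fun ψ => bloch ψ a * bloch ψ b) ((continuous_bloch a).mul (continuous_bloch b))
  have symm (a b : Fin 4) : ∫ ψ, bloch ψ a * bloch ψ b ∂haarState1 =
      ∫ ψ, bloch ψ b * bloch ψ a ∂haarState1 := by simp only [mul_comm]
  -- `X` and `Z` flip two coordinates each, which kills the mixed moments; `S` and `H` permute the
  -- coordinates up to sign, so the three diagonal moments agree, and they sum to one.
  have h00 : ∫ ψ, bloch ψ 0 * bloch ψ 0 ∂haarState1 = 1 := by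
    rw [integral_congr_ae (g := fun _ => (1 : ℝ))]
    · simp
    · filter_upwards [ae_haarState1_bloch_zero] with ψ hψ
      simp [hψ]
  have h01 : ∫ ψ, bloch ψ 0 * bloch ψ 1 ∂haarState1 = 0 := by
    have := key unitaryZ 0 1
    simp only [bloch_unitaryZ] at this
    simp [integral_neg] at this
    linarith
  have h02 : ∫ ψ, bloch ψ 0 * bloch ψ 2 ∂haarState1 = 0 := by
    have := key unitaryZ 0 2
    simp only [bloch_unitaryZ] at this
    simp [integral_neg] at this
    linarith
  have h03 : ∫ ψ, bloch ψ 0 * bloch ψ 3 ∂haarState1 = 0 := by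
    have := key unitaryX 0 3
    simp only [bloch_unitaryX] at this
    simp [integral_neg] at this
    linarith
  have h12 : ∫ ψ, bloch ψ 1 * bloch ψ 2 ∂haarState1 = 0 := by
    have := key unitaryX 1 2
    simp only [bloch_unitaryX] at this
    simp [integral_neg] at this
    linarith
  have h13 : ∫ ψ, bloch ψ 1 * bloch ψ 3 ∂haarState1 = 0 := by
    have := key unitaryX 1 3
    simp only [bloch_unitaryX] at this
    simp [integral_neg] at this
    linarith
  have h23 : ∫ ψ, bloch ψ 2 * bloch ψ 3 ∂haarState1 = 0 := by
    have := key unitaryZ 2 3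
    simp only [bloch_unitaryZ] at this
    simp [integral_neg] at this
    linarith
  have e12 := key unitaryS 2 2
  simp only [bloch_unitaryS] at e12
  simp at e12
  have e13 := key unitaryH 3 3
  simp only [bloch_unitaryH] at e13
  simp at e13
  have hsum : ∫ ψ, bloch ψ 1 * bloch ψ 1 ∂haarState1 + ∫ ψ, bloch ψ 2 * bloch ψ 2 ∂haarState1 +
      ∫ ψ, bloch ψ 3 * bloch ψ 3 ∂haarState1 = 1 := by
    rw [← h00, ← integral_add (integrable_haarState1 1 1) (integrable_haarState1 2 2),
      ← integral_add (by exact (integrable_haarState1 1 1).add (integrable_haarState1 2 2))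
        (integrable_haarState1 3 3)]
    refine integral_congr_ae (Filter.Eventually.of_forall fun ψ => ?_)
    have := sum_bloch_sq ψ
    simp only
    linarith
  have h11 : ∫ ψ, bloch ψ 1 * bloch ψ 1 ∂haarState1 = 1 / 3 := by linarith
  have h22 : ∫ ψ, bloch ψ 2 * bloch ψ 2 ∂haarState1 = 1 / 3 := by linarith
  have h33 : ∫ ψ, bloch ψ 3 * bloch ψ 3 ∂haarState1 = 1 / 3 := by linarith
  have h10 := (symm 1 0).trans h01
  have h20 := (symm 2 0).trans h02
  have h30 := (symm 3 0).trans h03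
  have h21 := (symm 2 1).trans h12
  have h31 := (symm 3 1).trans h13
  have h32 := (symm 3 2).trans h23
  fin_cases a <;> fin_cases b <;> simp <;> first | assumption | linarith

/-- The law of one product input with independent Haar-random factors. -/
def productLaw (n : ℕ) : Measure (Fin n → Fin 2 → ℂ) := Measure.pi fun _ => haarState1

instance (n : ℕ) : IsProbabilityMeasure (productLaw n) := by
  unfold productLaw; infer_instance

theorem ae_productLaw_bloch_zero (n : ℕ) : ∀ᵐ ψ ∂productLaw n, ∀ i, bloch (ψ i) 0 = 1 := by
  rw [ae_all_iff]
  intro i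
  exact (Measure.quasiMeasurePreserving_eval (fun _ : Fin n => haarState1) i).ae
    ae_haarState1_bloch_zero

theorem continuous_blochString {n : ℕ} (P : Fin n → Fin 4) : Continuous (blochString P) :=
  continuous_finsetProd _ fun i _ => (continuous_bloch (P i)).comp (continuous_apply i)

theorem abs_blochString_le_one {n : ℕ} (P : Fin n → Fin 4) {ψ : Fin n → Fin 2 → ℂ}
    (hψ : ∀ i, bloch (ψ i) 0 = 1) : |blochString P ψ| ≤ 1 := by
  rw [blochString, Finset.abs_prod]
  exact Finset.prod_le_one (fun _ _ => abs_nonneg _) fun i _ => abs_bloch_le_one (hψ i) _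

theorem abs_blochString_mul_le_one {n : ℕ} (P Q : Fin n → Fin 4) {ψ : Fin n → Fin 2 → ℂ}
    (hψ : ∀ i, bloch (ψ i) 0 = 1) : |blochString P ψ * blochString Q ψ| ≤ 1 := by
  rw [abs_mul]
  exact mul_le_one₀ (abs_blochString_le_one P hψ) (abs_nonneg _) (abs_blochString_le_one Q hψ)

theorem integrable_blochString_mul {n : ℕ} (P Q : Fin n → Fin 4) :
    Integrable (fun ψ => blochString P ψ * blochString Q ψ) (productLaw n) := by
  refine Integrable.of_mem_Icc (-1) 1
    ((continuous_blochString P).mul (continuous_blochString Q)).measurable.aemeasurable ?_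
  filter_upwards [ae_productLaw_bloch_zero n] with ψ hψ
  exact abs_le.mp (abs_blochString_mul_le_one P Q hψ)

theorem integral_blochString_mul {n : ℕ} (P Q : Fin n → Fin 4) :
    ∫ ψ, blochString P ψ * blochString Q ψ ∂productLaw n =
      if P = Q then ∏ i, (if P i = 0 then 1 else 1 / 3) else 0 := by
  simp only [blochString, ← Finset.prod_mul_distrib, productLaw]
  rw [integral_fintype_prod_eq_prod (fun (i : Fin n) ψ => bloch ψ (P i) * bloch ψ (Q i))]
  simp only [integral_bloch_mul_bloch]
  split_ifs with h
  · simp [h]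
  · obtain ⟨i, hi⟩ := Function.ne_iff.mp h
    exact Finset.prod_eq_zero (Finset.mem_univ i) (by simp [hi])

/-- The probability `|⟨Ψ|M|Ψ⟩|²` for the product state `Ψ = ⊗ᵢ ψᵢ`. -/
def overlap {n : ℕ} (M : Matrix (Bits n) (Bits n) ℂ) (ψ : Fin n → Fin 2 → ℂ) : ℝ :=
  Complex.normSq (expect M (tensorVec ψ))

theorem integral_overlap {n : ℕ} (M : Matrix (Bits n) (Bits n) ℂ) :
    ∫ ψ, overlap M ψ ∂productLaw n = ∑ P, ∑ Q, overlapCoeff M P Q *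
      ∫ ψ, blochString P ψ * blochString Q ψ ∂productLaw n := by
  simp only [overlap, normSq_expect_tensorVec]
  rw [integral_finsetSum _ fun P _ => integrable_finsetSum _ fun Q _ =>
    (integrable_blochString_mul P Q).const_mul _]
  refine Finset.sum_congr rfl fun P _ => ?_
  rw [integral_finsetSum _ fun Q _ => (integrable_blochString_mul P Q).const_mul _]
  exact Finset.sum_congr rfl fun Q _ => integral_const_mul _ _

/-- Every Pauli string but the identity is damped by a factor of at most `1/3` in the second
moment of a Haar-random product state. -/
theorem integral_overlap_le {n : ℕ} (M : UnitaryOp n) :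
    ∫ ψ, overlap (M : Matrix (Bits n) (Bits n) ℂ) ψ ∂productLaw n ≤
      1 / 3 + 2 / 3 * ((1 / 4) ^ n *
        Complex.normSq (M : Matrix (Bits n) (Bits n) ℂ).trace) := by
  set c : (Fin n → Fin 4) → ℝ := fun P => (1 / 4) ^ n *
    Complex.normSq (pauliCoeff (M : Matrix (Bits n) (Bits n) ℂ) P) with hc
  have hc0 : ∀ P, 0 ≤ c P := fun P => mul_nonneg (by positivity) (Complex.normSq_nonneg _)
  have hsum : ∑ P, c P = 1 := by
    rw [hc, ← Finset.mul_sum, sum_normSq_pauliCoeff_unitary, ← mul_pow]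
    norm_num
  have htr : c 0 = (1 / 4) ^ n * Complex.normSq (M : Matrix (Bits n) (Bits n) ℂ).trace := by
    rw [hc]; simp only [pauliCoeff_zero]
  have hint : ∫ ψ, overlap (M : Matrix (Bits n) (Bits n) ℂ) ψ ∂productLaw n =
      ∑ P, c P * ∏ i, (if P i = 0 then 1 else 1 / 3) := by
    rw [integral_overlap]
    refine Finset.sum_congr rfl fun P _ => ?_
    simp only [integral_blochString_mul, mul_ite, mul_zero, Finset.sum_ite_eq, Finset.mem_univ,
      if_true, hc, overlapCoeff]
    rw [Complex.star_def, Complex.mul_conj, Complex.ofReal_re]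
  have hle : ∀ P : Fin n → Fin 4, c P * ∏ i, (if P i = 0 then (1 : ℝ) else 1 / 3) ≤
      1 / 3 * c P + if P = 0 then 2 / 3 * c P else 0 := by
    intro P
    split_ifs with hP
    · subst hP; simp; linarith
    · obtain ⟨i, hi⟩ := Function.ne_iff.mp hP
      rw [Pi.zero_apply] at hi
      have h1 : ∏ i, (if P i = 0 then (1 : ℝ) else 1 / 3) ≤ 1 / 3 := by
        rw [← Finset.mul_prod_erase _ _ (Finset.mem_univ i), if_neg hi]
        refine mul_le_of_le_one_right (by norm_num) (Finset.prod_le_one ?_ ?_) <;>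
          intro j _ <;> split_ifs <;> norm_num
      nlinarith [hc0 P]
  rw [hint, ← htr]
  refine (Finset.sum_le_sum fun P _ => hle P).trans ?_
  rw [Finset.sum_add_distrib, ← Finset.mul_sum, hsum]
  simp

/-! ### The risk of a locally scrambled ensemble -/

section TraceNorm

variable {ι : Type*} [Fintype ι]

theorem mul_ketbra_mul_conjTranspose {κ : Type*} [Fintype κ] (A : Matrix κ ι ℂ) (ψ : ι → ℂ) :
    A * ketbra ψ * Aᴴ = ketbra (A *ᵥ ψ) := by
  rw [ketbra, mul_vecMulVec, vecMulVec_mul, ketbra, star_mulVec]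

theorem traceNorm_sq_le_rank_mul [DecidableEq ι] (A : Matrix ι ι ℂ) :
    traceNorm A ^ 2 ≤ A.rank * (Aᴴ * A).trace.re := by
  set hA := Matrix.isHermitian_conjTranspose_mul_self A
  have hnn : ∀ i, 0 ≤ hA.eigenvalues i :=
    (Matrix.posSemidef_conjTranspose_mul_self A).eigenvalues_nonneg
  have htr : (Aᴴ * A).trace.re = ∑ i, hA.eigenvalues i := by
    rw [hA.trace_eq_sum_eigenvalues, Complex.re_sum]
    rfl
  have hrank : A.rank = (Finset.univ.filter fun i => hA.eigenvalues i ≠ 0).card := by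
    rw [← Matrix.rank_conjTranspose_mul_self, hA.rank_eq_card_non_zero_eigs, Fintype.card_subtype]
  have hsum : traceNorm A =
      ∑ i ∈ Finset.univ.filter (fun i => hA.eigenvalues i ≠ 0), √(hA.eigenvalues i) := by
    rw [traceNorm]
    exact (Finset.sum_filter_of_ne (p := fun i => hA.eigenvalues i ≠ 0)
      fun i _ hi h0 => hi (by rw [h0, Real.sqrt_zero])).symm
  rw [hsum, hrank, htr]
  refine sq_sum_le_card_mul_sum_sq.trans (mul_le_mul_of_nonneg_left ?_ (Nat.cast_nonneg _))
  calc _ = ∑ i ∈ Finset.univ.filter (fun i => hA.eigenvalues i ≠ 0), hA.eigenvalues i :=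
        Finset.sum_congr rfl fun i _ => Real.sq_sqrt (hnn i)
    _ ≤ _ := Finset.sum_le_sum_of_subset_of_nonneg (Finset.filter_subset _ _)
        fun i _ _ => hnn i

theorem rank_ketbra_sub_ketbra_le (a b : ι → ℂ) : (ketbra a - ketbra b).rank ≤ 2 := by
  have h : ketbra a - ketbra b =
      (Matrix.of fun (x : ι) (i : Fin 2) => ![a x, b x] i) *
        (Matrix.of fun (i : Fin 2) (x : ι) => ![star (a x), -star (b x)] i) := by
    ext x y
    simp [ketbra, vecMulVec_apply, Matrix.mul_apply, Fin.sum_univ_two, sub_eq_add_neg]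
  rw [h]
  exact (Matrix.rank_mul_le_left _ _).trans ((Matrix.rank_le_card_width _).trans (by simp))

theorem trace_ketbra_mul_ketbra (a b : ι → ℂ) :
    (ketbra a * ketbra b).trace = Complex.normSq (star a ⬝ᵥ b) := by
  rw [ketbra, ketbra, vecMulVec_mul_vecMulVec, trace_vecMulVec, dotProduct_smul, smul_eq_mul,
    ← Complex.mul_conj]
  congr 1
  rw [starRingEnd_apply, star_dotProduct, star_star, dotProduct_comm]

theorem isHermitian_ketbra {κ : Type*} (a : κ → ℂ) : (ketbra a).IsHermitian := by
  ext x y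
  simp [ketbra, vecMulVec_apply, mul_comm]

/-- The trace distance of two pure states is bounded by their infidelity; this is in fact an
equality, since the two nonzero eigenvalues of the difference are opposite. -/
theorem traceNorm_ketbra_sub_ketbra_sq_le [DecidableEq ι] {a b : ι → ℂ} (ha : star a ⬝ᵥ a = 1)
    (hb : star b ⬝ᵥ b = 1) :
    traceNorm (ketbra a - ketbra b) ^ 2 ≤ 4 * (1 - Complex.normSq (star a ⬝ᵥ b)) := by
  refine (traceNorm_sq_le_rank_mul _).trans ?_
  have hsymm : Complex.normSq (star b ⬝ᵥ a) = Complex.normSq (star a ⬝ᵥ b) := by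
    rw [← Complex.normSq_conj, starRingEnd_apply, star_dotProduct, star_star, dotProduct_comm]
  have htr : ((ketbra a - ketbra b)ᴴ * (ketbra a - ketbra b)).trace.re =
      2 * (1 - Complex.normSq (star a ⬝ᵥ b)) := by
    rw [((isHermitian_ketbra a).sub (isHermitian_ketbra b)).eq, sub_mul, mul_sub, mul_sub]
    simp only [trace_sub, trace_ketbra_mul_ketbra, ha, hb, hsymm]
    simp
    ring
  have hnn : 0 ≤ ((ketbra a - ketbra b)ᴴ * (ketbra a - ketbra b)).trace.re :=
    (Complex.le_def.mp
      (Matrix.posSemidef_conjTranspose_mul_self (ketbra a - ketbra b)).trace_nonneg).1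
  have hr : ((ketbra a - ketbra b).rank : ℝ) ≤ 2 := by
    exact_mod_cast rank_ketbra_sub_ketbra_le a b
  calc _ ≤ 2 * ((ketbra a - ketbra b)ᴴ * (ketbra a - ketbra b)).trace.re :=
        mul_le_mul_of_nonneg_right hr hnn
    _ = _ := by rw [htr]; ring

theorem star_mulVec_dotProduct_mulVec (A B : Matrix ι ι ℂ) (ψ : ι → ℂ) :
    star (A *ᵥ ψ) ⬝ᵥ (B *ᵥ ψ) = expect (Aᴴ * B) ψ := by
  rw [expect, star_mulVec, ← dotProduct_mulVec, mulVec_mulVec]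

theorem star_dotProduct_unitary_mulVec [DecidableEq ι] (U : Matrix.unitaryGroup ι ℂ) (ψ : ι → ℂ) :
    star ((U : Matrix ι ι ℂ) *ᵥ ψ) ⬝ᵥ ((U : Matrix ι ι ℂ) *ᵥ ψ) = star ψ ⬝ᵥ ψ := by
  rw [star_mulVec_dotProduct_mulVec, ← star_eq_conjTranspose, Matrix.mem_unitaryGroup_iff'.mp U.2,
    expect, one_mulVec]

end TraceNorm

theorem star_zeroKet_dotProduct (n : ℕ) : star (zeroKet n) ⬝ᵥ zeroKet n = 1 := by
  simp [zeroKet, dotProduct, Pi.single_apply]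

theorem integrable_of_continuous_unitary {ι : Type*} [Fintype ι] [DecidableEq ι]
    {E : Type*} [NormedAddCommGroup E]
    {μ : Measure (Matrix.unitaryGroup ι ℂ)} [IsFiniteMeasure μ]
    {f : Matrix.unitaryGroup ι ℂ → E} (hf : Continuous f) : Integrable f μ :=
  hf.integrable_of_hasCompactSupport (HasCompactSupport.of_compactSpace f)

theorem continuous_expect {ι : Type*} [Fintype ι] (M : Matrix ι ι ℂ) :
    Continuous fun ψ : ι → ℂ => expect M ψ :=
  Continuous.dotProduct continuous_star (continuous_const.matrix_mulVec continuous_id)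

theorem continuous_normSq_expect_unitary {ι : Type*} [Fintype ι] [DecidableEq ι]
    (M : Matrix ι ι ℂ) (v : ι → ℂ) :
    Continuous fun W : Matrix.unitaryGroup ι ℂ =>
      Complex.normSq (expect M ((W : Matrix ι ι ℂ) *ᵥ v)) :=
  Complex.continuous_normSq.comp ((continuous_expect M).comp (continuous_unitary_mulVec v))

theorem kronecker_mulVec_mul {ι : Type*} [Fintype ι] (W : Matrix ι ι ℂ) (v : ι → ℂ) :
    (W ⊗ₖ W) *ᵥ (fun p : ι × ι => v p.1 * v p.2) = fun p => (W *ᵥ v) p.1 * (W *ᵥ v) p.2 := by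
  ext p
  simp only [mulVec, dotProduct, Finset.sum_mul_sum, Fintype.sum_prod_type, kroneckerMap_apply]
  exact Finset.sum_congr rfl fun x _ => Finset.sum_congr rfl fun y _ => by ring

/-- The averaged overlap `𝔼 |⟨0|W† M W|0⟩|²` only depends on the second moments of the ensemble. -/
theorem SameMomentsTwo.integral_normSq_expect_eq {n : ℕ} {μ ν : Measure (UnitaryOp n)}
    [IsFiniteMeasure μ] [IsFiniteMeasure ν] (h : SameMomentsTwo μ ν)
    (M : Matrix (Bits n) (Bits n) ℂ) :
    ∫ W : UnitaryOp n,
        Complex.normSq (expect M ((W : Matrix (Bits n) (Bits n) ℂ) *ᵥ zeroKet n)) ∂μ =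
      ∫ W : UnitaryOp n,
        Complex.normSq (expect M ((W : Matrix (Bits n) (Bits n) ℂ) *ᵥ zeroKet n)) ∂ν := by
  set v : Bits n × Bits n → ℂ := fun p => zeroKet n p.1 * zeroKet n p.2 with hv
  have hρ : IsDensity (ketbra v) := by
    refine ⟨Matrix.posSemidef_vecMulVec_self_star v, ?_⟩
    rw [ketbra, trace_vecMulVec]
    have h1 := star_zeroKet_dotProduct n
    simp only [dotProduct, Pi.star_apply] at h1
    simp only [dotProduct, hv, Pi.star_apply, star_mul', Fintype.sum_prod_type]
    calc _ = (∑ x, star (zeroKet n x) * zeroKet n x) * ∑ x, star (zeroKet n x) * zeroKet n x := by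
          rw [Finset.sum_mul_sum]
          exact Finset.sum_congr rfl fun x _ => Finset.sum_congr rfl fun y _ => by ring
      _ = 1 := by rw [h1, mul_one]
  have hexp (W : UnitaryOp n) :
      (Complex.normSq (expect M ((W : Matrix (Bits n) (Bits n) ℂ) *ᵥ zeroKet n)) : ℂ) =
      ∑ p : Bits n × Bits n, ∑ q : Bits n × Bits n, (M p.1 p.2 * star (M q.1 q.2)) *
        (((W : Matrix (Bits n) (Bits n) ℂ) ⊗ₖ (W : Matrix (Bits n) (Bits n) ℂ)) * ketbra v *
        ((W : Matrix (Bits n) (Bits n) ℂ) ⊗ₖ (W : Matrix (Bits n) (Bits n) ℂ))ᴴ)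
          (p.2, q.1) (p.1, q.2) := by
    rw [mul_ketbra_mul_conjTranspose, hv, kronecker_mulVec_mul, ← Complex.mul_conj, expect_eq_sum,
      ← Fintype.sum_prod_type', map_sum, Finset.sum_mul_sum]
    refine Finset.sum_congr rfl fun p _ => Finset.sum_congr rfl fun q _ => ?_
    simp only [ketbra, vecMulVec_apply, Pi.star_apply, map_mul, starRingEnd_apply, star_mul',
      star_star]
    ring
  have hcont (x y : Bits n × Bits n) : Continuous fun W : UnitaryOp n =>
      (((W : Matrix (Bits n) (Bits n) ℂ) ⊗ₖ (W : Matrix (Bits n) (Bits n) ℂ)) * ketbra v *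
        ((W : Matrix (Bits n) (Bits n) ℂ) ⊗ₖ (W : Matrix (Bits n) (Bits n) ℂ))ᴴ) x y := by
    have hw (a : Bits n) : Continuous fun W : UnitaryOp n =>
        ((W : Matrix (Bits n) (Bits n) ℂ) *ᵥ zeroKet n) a :=
      (continuous_apply a).comp (continuous_unitary_mulVec _)
    simp_rw [mul_ketbra_mul_conjTranspose, hv, kronecker_mulVec_mul]
    exact ((hw x.1).mul (hw x.2)).mul ((hw y.1).mul (hw y.2)).star
  have key (μ' : Measure (UnitaryOp n)) [IsFiniteMeasure μ'] :
      ((∫ W : UnitaryOp n, Complex.normSq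
        (expect M ((W : Matrix (Bits n) (Bits n) ℂ) *ᵥ zeroKet n)) ∂μ' : ℝ) : ℂ) =
      ∑ p : Bits n × Bits n, ∑ q : Bits n × Bits n, (M p.1 p.2 * star (M q.1 q.2)) *
        ∫ W : UnitaryOp n,
        (((W : Matrix (Bits n) (Bits n) ℂ) ⊗ₖ (W : Matrix (Bits n) (Bits n) ℂ)) * ketbra v *
        ((W : Matrix (Bits n) (Bits n) ℂ) ⊗ₖ (W : Matrix (Bits n) (Bits n) ℂ))ᴴ)
          (p.2, q.1) (p.1, q.2) ∂μ' := by
    rw [← integral_complex_ofReal]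
    simp only [hexp]
    rw [integral_finsetSum _ fun p _ => integrable_finsetSum _ fun q _ =>
      (integrable_of_continuous_unitary (hcont _ _)).const_mul _]
    refine Finset.sum_congr rfl fun p _ => ?_
    rw [integral_finsetSum _ fun q _ => (integrable_of_continuous_unitary (hcont _ _)).const_mul _]
    exact Finset.sum_congr rfl fun q _ => integral_const_mul _ _
  have hμν := (key μ).trans ((Finset.sum_congr rfl fun p _ => Finset.sum_congr rfl fun q _ => by
    rw [h.2 _ hρ]).trans (key ν).symm)
  exact_mod_cast hμν

/-- The product of bit flips that maps the all-zero state to the basis state `b`. -/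
def bitFlip {n : ℕ} (b : Bits n) : UnitaryOp n :=
  tensorUnitary fun i => if b i = 0 then 1 else unitaryX

theorem bitFlip_mulVec_zeroKet {n : ℕ} (b : Bits n) :
    (bitFlip b : Matrix (Bits n) (Bits n) ℂ) *ᵥ zeroKet n = Pi.single b 1 := by
  ext x
  have hi (a c : Fin 2) :
      ((if c = 0 then 1 else unitaryX : Unitary1) : Matrix (Fin 2) (Fin 2) ℂ) a 0 =
        if a = c then 1 else 0 := by
    fin_cases a <;> fin_cases c <;> simp [unitaryX]
  simp only [zeroKet, mulVec_single_one, col_apply, bitFlip, tensorUnitary, tensorMat, of_apply, hi,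
    Pi.single_apply]
  by_cases h : x = b
  · simp [h]
  · obtain ⟨i, hi⟩ := Function.ne_iff.mp h
    rw [if_neg h]
    exact Finset.prod_eq_zero (Finset.mem_univ i) (if_neg hi)

theorem normSq_sum_le_card_mul {ι : Type*} [Fintype ι] (z : ι → ℂ) :
    Complex.normSq (∑ i, z i) ≤ Fintype.card ι * ∑ i, Complex.normSq (z i) := by
  simp only [Complex.normSq_eq_norm_sq]
  calc ‖∑ i, z i‖ ^ 2 ≤ (∑ i, ‖z i‖) ^ 2 :=
        pow_le_pow_left₀ (norm_nonneg _) (norm_sum_le _ _) 2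
    _ ≤ _ := sq_sum_le_card_mul_sum_sq

/-- Averaging over bit flips turns `|⟨0|W† M W|0⟩|²` into the mean square of the diagonal of
`W† M W`, which is at least the square of its mean, and the trace does not see `W`. -/
theorem IsLocallyScrambled.le_integral_normSq_expect {n : ℕ} {ν : Measure (UnitaryOp n)}
    [IsProbabilityMeasure ν] (h : IsLocallyScrambled ν) (M : Matrix (Bits n) (Bits n) ℂ) :
    (1 / 4) ^ n * Complex.normSq M.trace ≤
      ∫ W : UnitaryOp n,
        Complex.normSq (expect M ((W : Matrix (Bits n) (Bits n) ℂ) *ᵥ zeroKet n)) ∂ν := by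
  set φ : UnitaryOp n → ℝ := fun W =>
    Complex.normSq (expect M ((W : Matrix (Bits n) (Bits n) ℂ) *ᵥ zeroKet n)) with hφ
  have hφc : Continuous φ := continuous_normSq_expect_unitary M _
  have hflip (b : Bits n) : ∫ W, φ W ∂ν = ∫ W, φ (W * bitFlip b) ∂ν := by
    have hb := h fun i => if b i = 0 then 1 else unitaryX
    conv_lhs => rw [← hb]
    rw [integral_map (continuous_mul_const _).measurable.aemeasurable hφc.aestronglyMeasurable]
    rfl
  have hcard : (Fintype.card (Bits n) : ℝ) = 2 ^ n := by simp
  have hdiag (W : UnitaryOp n) (b : Bits n) : φ (W * bitFlip b) =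
      Complex.normSq (((W : Matrix (Bits n) (Bits n) ℂ)ᴴ * M * W) b b) := by
    rw [hφ]
    simp only [Submonoid.coe_mul]
    rw [← mulVec_mulVec, bitFlip_mulVec_zeroKet, expect, star_mulVec, ← dotProduct_mulVec,
      mulVec_mulVec, mulVec_mulVec, mulVec_single_one]
    congr 1
    simp [dotProduct, Pi.single_apply]
  have htr (W : UnitaryOp n) : Complex.normSq M.trace ≤ 2 ^ n * ∑ b, φ (W * bitFlip b) := by
    have h1 : M.trace = ∑ b, ((W : Matrix (Bits n) (Bits n) ℂ)ᴴ * M * W) b b := by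
      change _ = ((W : Matrix (Bits n) (Bits n) ℂ)ᴴ * M * W).trace
      rw [trace_mul_comm, ← Matrix.mul_assoc, ← star_eq_conjTranspose,
        Matrix.mem_unitaryGroup_iff.mp W.2, Matrix.one_mul]
    rw [h1, ← hcard]
    simp only [hdiag]
    exact normSq_sum_le_card_mul _
  have hint (b : Bits n) : Integrable (fun W => φ (W * bitFlip b)) ν :=
    integrable_of_continuous_unitary (hφc.comp (continuous_mul_const _))
  have hsum : Complex.normSq M.trace ≤ 2 ^ n * (2 ^ n * ∫ W, φ W ∂ν) := by
    calc Complex.normSq M.trace = ∫ _, Complex.normSq M.trace ∂ν := by simp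
      _ ≤ ∫ W, 2 ^ n * ∑ b, φ (W * bitFlip b) ∂ν :=
        integral_mono (integrable_const _)
          ((integrable_finsetSum _ fun b _ => hint b).const_mul _) htr
      _ = 2 ^ n * ∑ b : Bits n, ∫ W, φ (W * bitFlip b) ∂ν := by
        rw [integral_const_mul, integral_finsetSum _ fun b _ => hint b]
      _ = _ := by
        simp only [← hflip, Finset.sum_const, Finset.card_univ, nsmul_eq_mul, hcard]
  calc (1 / 4) ^ n * Complex.normSq M.trace
      ≤ (1 / 4) ^ n * (2 ^ n * (2 ^ n * ∫ W, φ W ∂ν)) := by gcongr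
    _ = (1 / 4 * 2 * 2) ^ n * ∫ W, φ W ∂ν := by rw [mul_pow, mul_pow]; ring
    _ = _ := by norm_num

theorem normSq_expect_le_one {ι : Type*} [Fintype ι] [DecidableEq ι] (M : Matrix.unitaryGroup ι ℂ)
    {ψ : ι → ℂ} (hψ : star ψ ⬝ᵥ ψ = 1) : Complex.normSq (expect (M : Matrix ι ι ℂ) ψ) ≤ 1 := by
  have hb : star ((M : Matrix ι ι ℂ) *ᵥ ψ) ⬝ᵥ ((M : Matrix ι ι ℂ) *ᵥ ψ) = 1 := by
    rw [star_dotProduct_unitary_mulVec, hψ]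
  have h := (sq_nonneg _).trans (traceNorm_ketbra_sub_ketbra_sq_le hψ hb)
  rw [expect]
  linarith

/-- The risk of every ensemble that is locally scrambled up to second moments is at most the
normalized Hilbert-Schmidt distance `1 - |Tr (U† V)|² / d²`. -/
theorem risk_le_one_sub_trace {n : ℕ} {P : Measure (Bits n → ℂ)}
    (hP : IsLocallyScrambledStatesTwo P) (U V : UnitaryOp n) :
    risk P U V ≤ 1 - (1 / 4) ^ n *
      Complex.normSq (((U⁻¹ * V : UnitaryOp n) : Matrix (Bits n) (Bits n) ℂ)).trace := by
  obtain ⟨μ, ⟨hμ, ν, hν, hls, hmom⟩, rfl⟩ := hP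
  set M : UnitaryOp n := U⁻¹ * V with hM
  have hMcoe : (M : Matrix (Bits n) (Bits n) ℂ) = (U : Matrix (Bits n) (Bits n) ℂ)ᴴ * V := rfl
  have hmeas := (continuous_unitary_mulVec (zeroKet n)).measurable.aemeasurable (μ := μ)
  have hcont : Continuous fun ψ : Bits n → ℂ =>
      4 * (1 - Complex.normSq (expect (M : Matrix (Bits n) (Bits n) ℂ) ψ)) :=
    continuous_const.mul (continuous_const.sub
      (Complex.continuous_normSq.comp (continuous_expect _)))
  have hcontW := continuous_normSq_expect_unitary (M : Matrix (Bits n) (Bits n) ℂ) (zeroKet n)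
  have hnorm : ∀ᵐ ψ ∂(μ.map fun U : UnitaryOp n =>
      (U : Matrix (Bits n) (Bits n) ℂ) *ᵥ zeroKet n), star ψ ⬝ᵥ ψ = 1 := by
    have hc : Continuous fun ψ : Bits n → ℂ => star ψ ⬝ᵥ ψ :=
      continuous_star.dotProduct continuous_id
    rw [ae_map_iff hmeas (isClosed_eq hc continuous_const).measurableSet]
    refine Filter.Eventually.of_forall fun W => ?_
    rw [star_dotProduct_unitary_mulVec, star_zeroKet_dotProduct]
  have hle : ∫ ψ, traceNorm
      ((U : Matrix (Bits n) (Bits n) ℂ) * ketbra ψ * (U : Matrix (Bits n) (Bits n) ℂ)ᴴ -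
        (V : Matrix (Bits n) (Bits n) ℂ) * ketbra ψ * (V : Matrix (Bits n) (Bits n) ℂ)ᴴ) ^ 2
      ∂(μ.map fun U : UnitaryOp n => (U : Matrix (Bits n) (Bits n) ℂ) *ᵥ zeroKet n) ≤
      ∫ ψ, 4 * (1 - Complex.normSq (expect (M : Matrix (Bits n) (Bits n) ℂ) ψ))
      ∂(μ.map fun U : UnitaryOp n => (U : Matrix (Bits n) (Bits n) ℂ) *ᵥ zeroKet n) := by
    -- Only the upper bound has to be integrable, so the measurability of the trace norm is not
    -- needed.
    refine integral_mono_of_nonneg (Filter.Eventually.of_forall fun ψ => sq_nonneg _) ?_ ?_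
    · rw [integrable_map_measure hcont.aestronglyMeasurable hmeas]
      exact integrable_of_continuous_unitary (hcont.comp (continuous_unitary_mulVec _))
    · filter_upwards [hnorm] with ψ hψ
      rw [mul_ketbra_mul_conjTranspose, mul_ketbra_mul_conjTranspose, hMcoe,
        ← star_mulVec_dotProduct_mulVec]
      exact traceNorm_ketbra_sub_ketbra_sq_le
        ((star_dotProduct_unitary_mulVec U ψ).trans hψ)
        ((star_dotProduct_unitary_mulVec V ψ).trans hψ)
  have hbound := hls.le_integral_normSq_expect (M : Matrix (Bits n) (Bits n) ℂ)
  rw [← hmom.integral_normSq_expect_eq] at hbound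
  rw [integral_map hmeas hcont.aestronglyMeasurable, integral_const_mul,
    integral_sub (integrable_const _) (integrable_of_continuous_unitary hcontW)] at hle
  simp only [integral_const, probReal_univ, smul_eq_mul, mul_one] at hle
  rw [risk]
  linarith

/-- Passing from an arbitrary locally scrambled ensemble to Haar-random product states costs at
most a factor of `2`. -/
theorem risk_le_two_mul_integral {n : ℕ} {P : Measure (Bits n → ℂ)}
    (hP : IsLocallyScrambledStatesTwo P) (U V : UnitaryOp n) :
    risk P U V ≤ 2 * (1 - ∫ ψ, overlap
      ((U⁻¹ * V : UnitaryOp n) : Matrix (Bits n) (Bits n) ℂ) ψ ∂productLaw n) := by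
  have h1 := risk_le_one_sub_trace hP U V
  have h2 := integral_overlap_le (U⁻¹ * V)
  have h3 : 0 ≤ risk P U V :=
    mul_nonneg (by norm_num) (integral_nonneg fun ψ => sq_nonneg _)
  linarith

/-! ### Global infidelity and local cost -/

section Expect

variable {ι : Type*} [Fintype ι]

theorem expect_conj (A B : Matrix ι ι ℂ) (ψ : ι → ℂ) :
    expect (B * A * Bᴴ) ψ = expect A (Bᴴ *ᵥ ψ) := by
  rw [expect, expect, star_mulVec, conjTranspose_conjTranspose, ← dotProduct_mulVec,
    mulVec_mulVec, mulVec_mulVec, Matrix.mul_assoc]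

theorem trace_ketbra_mul (A : Matrix ι ι ℂ) (ψ : ι → ℂ) :
    (ketbra ψ * A).trace = expect A ψ := by
  rw [ketbra, vecMulVec_mul, trace_vecMulVec, expect, dotProduct_mulVec, dotProduct_comm]

theorem expect_smul_sum {κ : Type*} [Fintype κ] (c : ℂ) (A : κ → Matrix ι ι ℂ) (ψ : ι → ℂ) :
    expect (c • ∑ i, A i) ψ = c * ∑ i, expect (A i) ψ := by
  simp only [expect, smul_mulVec, Matrix.sum_mulVec, dotProduct_smul, dotProduct_sum, smul_eq_mul]

end Expect

/-- A one-qubit unitary whose first column is the unit vector `ψ`. -/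
def frame (ψ : Fin 2 → ℂ) (h : bloch ψ 0 = 1) : Unitary1 :=
  ⟨!![ψ 0, -star (ψ 1); ψ 1, star (ψ 0)], by
    have h' : ((Complex.normSq (ψ 0) + Complex.normSq (ψ 1) : ℝ) : ℂ) = 1 := by
      rw [← Complex.ofReal_one]; exact congrArg _ h
    push_cast at h'
    rw [← Complex.mul_conj, ← Complex.mul_conj] at h'
    rw [Matrix.mem_unitaryGroup_iff]
    ext i j
    fin_cases i <;> fin_cases j <;> simp [Matrix.mul_apply, Fin.sum_univ_two]
    · linear_combination h'
    · ring
    · ring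
    · linear_combination h'⟩

theorem frame_mul_mul_star (ψ : Fin 2 → ℂ) (h : bloch ψ 0 = 1) :
    (frame ψ h : Matrix (Fin 2) (Fin 2) ℂ) * ketbra (Pi.single 0 1) *
      star (frame ψ h : Matrix (Fin 2) (Fin 2) ℂ) = ketbra ψ := by
  rw [star_eq_conjTranspose, mul_ketbra_mul_conjTranspose]
  congr 1
  rw [mulVec_single_one]
  ext i
  fin_cases i <;> simp [frame]

theorem onQubit_ketbra {n : ℕ} (ψ : Fin n → Fin 2 → ℂ) (h : ∀ i, bloch (ψ i) 0 = 1) (i : Fin n) :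
    onQubit i (ketbra (ψ i)) =
      (tensorUnitary fun i => frame (ψ i) (h i) : Matrix (Bits n) (Bits n) ℂ) *
        onQubit i (ketbra (Pi.single 0 1)) *
        (tensorUnitary fun i => frame (ψ i) (h i) : Matrix (Bits n) (Bits n) ℂ)ᴴ := by
  rw [← star_eq_conjTranspose]
  simp only [onQubit, tensorUnitary, star_tensorMat, tensorMat_mul]
  congr 1
  funext j
  by_cases hj : j = i
  · subst hj
    simp [frame_mul_mul_star]
  · simp [Function.update_of_ne hj, Matrix.mem_unitaryGroup_iff.mp (frame (ψ j) (h j)).2]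

theorem tensorVec_eq_mulVec {n : ℕ} (ψ : Fin n → Fin 2 → ℂ) (h : ∀ i, bloch (ψ i) 0 = 1) :
    tensorVec ψ =
      (tensorUnitary fun i => frame (ψ i) (h i) : Matrix (Bits n) (Bits n) ℂ) *ᵥ zeroKet n := by
  ext x
  rw [zeroKet, mulVec_single_one]
  simp only [tensorVec, col_apply, tensorUnitary, tensorMat, of_apply]
  refine Finset.prod_congr rfl fun i _ => ?_
  generalize x i = a
  fin_cases a <;> simp [frame]

theorem expect_onQubit_zero {n : ℕ} (i : Fin n) (φ : Bits n → ℂ) :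
    expect (onQubit i (ketbra (Pi.single 0 1))) φ =
      ((∑ x, if x i = 0 then Complex.normSq (φ x) else 0 : ℝ) : ℂ) := by
  have hdiag (x y : Bits n) : onQubit i (ketbra (Pi.single 0 1)) x y =
      if x = y ∧ x i = 0 then 1 else 0 := by
    simp only [onQubit, tensorMat, of_apply]
    split_ifs with h
    · obtain ⟨rfl, h0⟩ := h
      refine Finset.prod_eq_one fun j _ => ?_
      by_cases hj : j = i
      · subst hj
        simp [ketbra, vecMulVec_apply, h0]
      · simp [Function.update_of_ne hj]
    · rw [not_and_or] at h
      by_cases hi : x i = 0 ∧ y i = 0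
      · obtain ⟨j, hj⟩ := Function.ne_iff.mp (h.resolve_right fun h' => h' hi.1)
        have hji : j ≠ i := by
          rintro rfl
          exact hj (hi.1.trans hi.2.symm)
        refine Finset.prod_eq_zero (Finset.mem_univ j) ?_
        simp [Function.update_of_ne hji, Matrix.one_apply_ne hj]
      · refine Finset.prod_eq_zero (Finset.mem_univ i) ?_
        rw [Function.update_self, ketbra, vecMulVec_apply]
        rcases not_and_or.mp hi with h' | h' <;> simp [Pi.single_apply, h']
  rw [expect_eq_sum]
  push_cast
  refine Finset.sum_congr rfl fun x _ => ?_
  rw [Finset.sum_eq_single x]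
  · rw [hdiag]
    split_ifs with h1 h2 h2 <;> simp_all [Complex.mul_conj]
  · intro y _ hy
    rw [hdiag, if_neg fun h => hy h.1.symm, zero_mul]
  · simp

theorem star_dotProduct_self {ι : Type*} [Fintype ι] (φ : ι → ℂ) :
    star φ ⬝ᵥ φ = ((∑ x, Complex.normSq (φ x) : ℝ) : ℂ) := by
  push_cast
  refine Finset.sum_congr rfl fun x _ => ?_
  rw [← Complex.mul_conj, mul_comm, Pi.star_apply, starRingEnd_apply]

theorem star_tensorVec_dotProduct {n : ℕ} {ψ : Fin n → Fin 2 → ℂ} (h : ∀ i, bloch (ψ i) 0 = 1) :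
    star (tensorVec ψ) ⬝ᵥ tensorVec ψ = 1 := by
  rw [tensorVec_eq_mulVec ψ h, star_dotProduct_unitary_mulVec, star_zeroKet_dotProduct]

/-- The infidelity of an `n`-qubit state with the all-zero string is at most the sum of its
one-qubit infidelities, by the union bound for the measurement in the computational basis. -/
theorem one_sub_le_sum_one_sub {n : ℕ} {p : Bits n → ℝ} (hp : ∀ x, 0 ≤ p x) (hsum : ∑ x, p x = 1) :
    1 - p 0 ≤ ∑ i, (1 - ∑ x, if x i = 0 then p x else 0) := by
  have h1 (i : Fin n) :
      (1 - ∑ x, if x i = 0 then p x else 0) = ∑ x, if x i = 0 then 0 else p x := by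
    rw [← hsum, ← Finset.sum_sub_distrib]
    refine Finset.sum_congr rfl fun x _ => ?_
    split_ifs <;> simp
  have h2 : 1 - p 0 = ∑ x, if x = 0 then 0 else p x := by
    rw [← hsum, sub_eq_iff_eq_add]
    rw [← Fintype.sum_ite_eq' (0 : Bits n) p, ← Finset.sum_add_distrib]
    refine Finset.sum_congr rfl fun x _ => ?_
    split_ifs <;> simp
  rw [h2]
  simp only [h1]
  rw [Finset.sum_comm]
  refine Finset.sum_le_sum fun x _ => ?_
  have hnn (i : Fin n) : 0 ≤ if x i = 0 then 0 else p x := by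
    split_ifs
    exacts [le_rfl, hp x]
  split_ifs with hx
  · exact Finset.sum_nonneg fun i _ => hnn i
  · obtain ⟨i, hi⟩ := Function.ne_iff.mp hx
    rw [Pi.zero_apply] at hi
    refine le_trans ?_ (Finset.single_le_sum (fun j _ => hnn j) (Finset.mem_univ i))
    rw [if_neg hi]

/-- On a single product input, the global infidelity is at most `n` times the local loss. -/
theorem one_sub_overlap_le_local {n : ℕ} (hn : 1 ≤ n) (M : UnitaryOp n) {ψ : Fin n → Fin 2 → ℂ}
    (h : ∀ i, bloch (ψ i) 0 = 1) :
    1 - overlap (M : Matrix (Bits n) (Bits n) ℂ) ψ ≤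
      n * (1 - (expect ((M : Matrix (Bits n) (Bits n) ℂ) * localH ψ *
        (M : Matrix (Bits n) (Bits n) ℂ)ᴴ) (tensorVec ψ)).re) := by
  set u : UnitaryOp n := tensorUnitary fun i => frame (ψ i) (h i) with hu
  -- `φ` is the output state `M† Ψ` in the product basis that contains `Ψ` as its all-zero vector.
  set φ : Bits n → ℂ := (u : Matrix (Bits n) (Bits n) ℂ)ᴴ *ᵥ
    ((M : Matrix (Bits n) (Bits n) ℂ)ᴴ *ᵥ tensorVec ψ) with hφ
  have hover : overlap (M : Matrix (Bits n) (Bits n) ℂ) ψ = Complex.normSq (φ 0) := by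
    have h0 : star φ ⬝ᵥ zeroKet n = expect (M : Matrix (Bits n) (Bits n) ℂ) (tensorVec ψ) := by
      rw [hφ, star_mulVec, conjTranspose_conjTranspose, ← dotProduct_mulVec, hu,
        ← tensorVec_eq_mulVec ψ h, star_mulVec, conjTranspose_conjTranspose, ← dotProduct_mulVec,
        expect]
    rw [overlap, ← h0, zeroKet, dotProduct_single_one, Pi.star_apply, Complex.star_def,
      Complex.normSq_conj]
    rfl
  have hsum : ∑ x, Complex.normSq (φ x) = 1 := by
    have h1 : star φ ⬝ᵥ φ = 1 := by
      have e1 := star_dotProduct_unitary_mulVec u⁻¹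
        ((M : Matrix (Bits n) (Bits n) ℂ)ᴴ *ᵥ tensorVec ψ)
      have e2 := star_dotProduct_unitary_mulVec M⁻¹ (tensorVec ψ)
      exact e1.trans (e2.trans (star_tensorVec_dotProduct h))
    rw [star_dotProduct_self] at h1
    exact_mod_cast h1
  have hloc : (expect ((M : Matrix (Bits n) (Bits n) ℂ) * localH ψ *
      (M : Matrix (Bits n) (Bits n) ℂ)ᴴ) (tensorVec ψ)).re =
      1 / n * ∑ i, ∑ x, if x i = 0 then Complex.normSq (φ x) else 0 := by
    have hi (i : Fin n) : expect (onQubit i (ketbra (ψ i)))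
        ((M : Matrix (Bits n) (Bits n) ℂ)ᴴ *ᵥ tensorVec ψ) =
        ((∑ x, if x i = 0 then Complex.normSq (φ x) else 0 : ℝ) : ℂ) := by
      rw [onQubit_ketbra ψ h i, expect_conj, expect_onQubit_zero]
    rw [expect_conj, localH, expect_smul_sum]
    simp only [hi]
    rw [← Complex.ofReal_sum]
    have : (1 / n : ℂ) = ((1 / n : ℝ) : ℂ) := by push_cast; rfl
    rw [this, ← Complex.ofReal_mul, Complex.ofReal_re]
  have hn0 : (n : ℝ) ≠ 0 := by positivity
  rw [hover, hloc]
  refine (one_sub_le_sum_one_sub (fun x => Complex.normSq_nonneg (φ x)) hsum).trans_eq ?_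
  rw [Finset.sum_sub_distrib]
  field_simp
  simp

/-- The empirical global infidelity is at most `n` times the local training cost. -/
theorem mean_one_sub_overlap_le {n N : ℕ} (hn : 1 ≤ n) (hN : 1 ≤ N)
    {D : Fin N → Fin n → Fin 2 → ℂ} (h : ∀ j i, bloch (D j i) 0 = 1) (U V : UnitaryOp n) :
    1 - (1 / N : ℝ) * ∑ j, overlap ((U⁻¹ * V : UnitaryOp n) : Matrix (Bits n) (Bits n) ℂ) (D j) ≤
      n * localCost D U V := by
  set M : UnitaryOp n := U⁻¹ * V with hM
  have hN0 : (N : ℝ) ≠ 0 := by positivity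
  have hterm (j : Fin N) : Matrix.trace
      (ketbra (tensorVec (D j)) * (U : Matrix (Bits n) (Bits n) ℂ)ᴴ *
        (V : Matrix (Bits n) (Bits n) ℂ) * localH (D j) *
        (V : Matrix (Bits n) (Bits n) ℂ)ᴴ * (U : Matrix (Bits n) (Bits n) ℂ)) =
      expect ((M : Matrix (Bits n) (Bits n) ℂ) * localH (D j) *
        (M : Matrix (Bits n) (Bits n) ℂ)ᴴ) (tensorVec (D j)) := by
    have hMcoe : (M : Matrix (Bits n) (Bits n) ℂ) = (U : Matrix (Bits n) (Bits n) ℂ)ᴴ * V := rfl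
    rw [← trace_ketbra_mul, hMcoe, conjTranspose_mul, conjTranspose_conjTranspose]
    simp only [Matrix.mul_assoc]
  have hmean (f : Fin N → ℝ) : 1 - (1 / N : ℝ) * ∑ j, f j = (1 / N : ℝ) * ∑ j, (1 - f j) := by
    rw [Finset.sum_sub_distrib]
    field_simp
    simp
  rw [localCost]
  simp only [hterm]
  rw [hmean, hmean, mul_left_comm, Finset.mul_sum (s := Finset.univ) (a := (n : ℝ))]
  exact mul_le_mul_of_nonneg_left
    (Finset.sum_le_sum fun j _ => one_sub_overlap_le_local hn M (h j))
    (one_div_nonneg.mpr (Nat.cast_nonneg N))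

/-! ### Uniform deviations of finite classes -/

/-- The deviation of the empirical mean of `f` over the sample `D` from its expectation. -/
def deviation {Ω : Type*} [MeasurableSpace Ω] (μ : Measure Ω) {N : ℕ} (f : Ω → ℝ)
    (D : Fin N → Ω) : ℝ :=
  (1 / N : ℝ) * ∑ j, f (D j) - ∫ ω, f ω ∂μ

section Hoeffding

variable {Ω : Type*} [MeasurableSpace Ω] (μ : Measure Ω)

/-- Hoeffding's inequality for the empirical mean of a function with values in `[-1, 1]`. -/
theorem measure_deviation_ge_le [IsProbabilityMeasure μ] {N : ℕ} (hN : 1 ≤ N) {f : Ω → ℝ}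
    (hf : Measurable f) (hb : ∀ᵐ ω ∂μ, |f ω| ≤ 1) {τ : ℝ} (hτ : 0 ≤ τ) :
    (Measure.pi fun _ : Fin N => μ).real {D | τ ≤ deviation μ f D} ≤ Real.exp (-N * τ ^ 2 / 2) := by
  have hN0 : (0 : ℝ) < N := by positivity
  have hsub : ProbabilityTheory.HasSubgaussianMGF (fun ω => f ω - ∫ ω, f ω ∂μ)
      ((‖(1 : ℝ) - (-1)‖₊ / 2) ^ 2) μ :=
    ProbabilityTheory.hasSubgaussianMGF_of_mem_Icc hf.aemeasurable
      (hb.mono fun ω h => abs_le.mp h)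
  have hone : ((‖(1 : ℝ) - (-1)‖₊ / 2) ^ 2 : NNReal) = 1 := by
    have : ‖(1 : ℝ) - (-1)‖₊ = 2 := by
      rw [← NNReal.coe_inj]; norm_num
    rw [this]; norm_num
  rw [hone] at hsub
  have hind := ProbabilityTheory.iIndepFun_pi (μ := fun _ : Fin N => μ)
    (X := fun _ ω => f ω - ∫ ω, f ω ∂μ) fun _ => (hf.sub_const _).aemeasurable
  have hj (j : Fin N) : ProbabilityTheory.HasSubgaussianMGF
      (fun D : Fin N → Ω => f (D j) - ∫ ω, f ω ∂μ) 1 (Measure.pi fun _ : Fin N => μ) := by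
    have heval := measurePreserving_eval (fun _ : Fin N => μ) j
    obtain ⟨m, hm⟩ : ∃ m, m = ∫ ω, f ω ∂μ := ⟨_, rfl⟩
    rw [← hm] at hsub ⊢
    rw [← heval.map_eq] at hsub
    exact hsub.of_map heval.measurable.aemeasurable
  have key := ProbabilityTheory.HasSubgaussianMGF.measure_sum_ge_le_of_iIndepFun hind
    (s := Finset.univ) (c := fun _ => 1) (fun j _ => hj j) (mul_nonneg hN0.le hτ)
  have hset : {D : Fin N → Ω | τ ≤ deviation μ f D} =
      {D | N * τ ≤ ∑ j, (f (D j) - ∫ ω, f ω ∂μ)} := by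
    ext D
    simp only [Set.mem_ofPred_eq, deviation, Finset.sum_sub_distrib, Finset.sum_const,
      Finset.card_univ, Fintype.card_fin, nsmul_eq_mul]
    rw [← mul_le_mul_iff_of_pos_left hN0]
    have : (N : ℝ) * (1 / N * ∑ j, f (D j) - ∫ ω, f ω ∂μ) =
        ∑ j, f (D j) - N * ∫ ω, f ω ∂μ := by field_simp
    rw [this]
  rw [hset]
  refine key.trans_eq ?_
  congr 1
  simp
  field_simp

theorem measurable_deviation {N : ℕ} {f : Ω → ℝ} (hf : Measurable f) :
    Measurable fun D : Fin N → Ω => deviation μ f D :=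
  (measurable_const.mul (Finset.measurable_sum _ fun j _ =>
    hf.comp (measurable_pi_apply j))).sub_const _

/-- Uniform convergence over a finite class, by Hoeffding's inequality and the union bound. -/
theorem le_measure_forall_deviation_le [IsProbabilityMeasure μ] {N : ℕ} (hN : 1 ≤ N)
    {κ : Type*} [Fintype κ] {f : κ → Ω → ℝ} (hf : ∀ l, Measurable (f l))
    (hb : ∀ l, ∀ᵐ ω ∂μ, |f l ω| ≤ 1) {B δ : ℝ} (hδ : 0 < δ) (hδ1 : δ < 1) (hB : 1 ≤ B) (hcard : (Fintype.card κ : ℝ) ≤ B) :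
    ENNReal.ofReal (1 - δ) ≤ (Measure.pi fun _ : Fin N => μ)
      {D | ∀ l, deviation μ (f l) D ≤ √(2 * Real.log (B / δ) / N)} := by
  have hN0 : (0 : ℝ) < N := by positivity
  set τ := √(2 * Real.log (B / δ) / N) with hτ
  have hlog : 0 ≤ Real.log (B / δ) := by
    refine Real.log_nonneg ?_
    rw [le_div_iff₀ hδ]
    linarith
  have hτ0 : 0 ≤ τ := Real.sqrt_nonneg _
  have hexp : Real.exp (-N * τ ^ 2 / 2) = δ / B := by
    have hx : -N * τ ^ 2 / 2 = -Real.log (B / δ) := by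
      rw [hτ, Real.sq_sqrt (by positivity)]
      field_simp
    rw [hx, Real.exp_neg, Real.exp_log (by positivity), inv_div]
  set ν := Measure.pi fun _ : Fin N => μ with hν
  -- The event is enlarged to non-strict inequalities on the bad side; it then has probability
  -- at most `card κ * (δ / B) ≤ δ`.
  set bad : Set (Fin N → Ω) := ⋃ l, {D | τ ≤ deviation μ (f l) D} with hbad
  have hmeas : MeasurableSet bad :=
    MeasurableSet.iUnion fun l => measurableSet_le measurable_const (measurable_deviation μ (hf l))
  have hle : ν.real bad ≤ δ := by
    calc ν.real bad ≤ ∑ l, ν.real {D | τ ≤ deviation μ (f l) D} := measureReal_iUnion_fintype_le _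
      _ ≤ ∑ _l : κ, δ / B := Finset.sum_le_sum fun l _ =>
          (measure_deviation_ge_le μ hN (hf l) (hb l) hτ0).trans_eq hexp
      _ = Fintype.card κ * (δ / B) := by simp
      _ ≤ B * (δ / B) := by gcongr
      _ = δ := by field_simp
  have hsub : badᶜ ⊆ {D | ∀ l, deviation μ (f l) D ≤ τ} := by
    intro D hD l
    simp only [hbad, Set.compl_iUnion, Set.mem_iInter, Set.mem_compl_iff, Set.mem_ofPred_eq,
      not_le] at hD
    exact (hD l).le
  refine le_trans ?_ (measure_mono hsub)
  rw [ENNReal.ofReal_le_iff_le_toReal (measure_ne_top _ _)]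
  change _ ≤ ν.real badᶜ
  rw [probReal_compl_eq_one_sub hmeas]
  linarith

end Hoeffding

/-! ### Stability of the overlap under perturbations of the circuit -/

theorem norm_unitaryOp_apply_le {n : ℕ} (M : UnitaryOp n) (x y : Bits n) :
    ‖(M : Matrix (Bits n) (Bits n) ℂ) x y‖ ≤ 1 :=
  entry_norm_bound_of_unitary M.2 x y

theorem sum_sum_norm_le {n : ℕ} {f : Bits n → Bits n → ℂ} {ε : ℝ} (h : ∀ x y, ‖f x y‖ ≤ ε) :
    ‖∑ x, ∑ y, f x y‖ ≤ 4 ^ n * ε := by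
  calc ‖∑ x, ∑ y, f x y‖ ≤ ∑ x : Bits n, ∑ y : Bits n, ε :=
        norm_sum_le_of_le _ fun x _ => norm_sum_le_of_le _ fun y _ => h x y
    _ = 4 ^ n * ε := by
      simp only [Finset.sum_const, Finset.card_univ, Fintype.card_fun, Fintype.card_fin,
        nsmul_eq_mul]
      push_cast
      rw [← mul_assoc, ← mul_pow]
      norm_num

theorem norm_mul_mul_sub_apply_le {n : ℕ} {G G' : UnitaryOp n} {η : ℝ}
    (h : ∀ x y, ‖(G : Matrix (Bits n) (Bits n) ℂ) x y -
      (G' : Matrix (Bits n) (Bits n) ℂ) x y‖ ≤ η) (L R : UnitaryOp n) (x y : Bits n) :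
    ‖((L * G * R : UnitaryOp n) : Matrix (Bits n) (Bits n) ℂ) x y -
      ((L * G' * R : UnitaryOp n) : Matrix (Bits n) (Bits n) ℂ) x y‖ ≤ 4 ^ n * η := by
  have hexp (G : UnitaryOp n) : ((L * G * R : UnitaryOp n) : Matrix (Bits n) (Bits n) ℂ) x y =
      ∑ b, ∑ a, (L : Matrix (Bits n) (Bits n) ℂ) x a * (G : Matrix (Bits n) (Bits n) ℂ) a b *
        (R : Matrix (Bits n) (Bits n) ℂ) b y := by
    simp only [Submonoid.coe_mul, Matrix.mul_apply, Finset.sum_mul]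
  rw [hexp, hexp]
  simp only [← Finset.sum_sub_distrib, ← sub_mul, ← mul_sub]
  refine sum_sum_norm_le fun b a => ?_
  rw [norm_mul, norm_mul]
  have h1 := norm_unitaryOp_apply_le L x a
  have h2 := norm_unitaryOp_apply_le R b y
  have h3 := h a b
  have h4 : 0 ≤ η := (norm_nonneg _).trans h3
  calc _ ≤ 1 * η * 1 := by gcongr
    _ = η := by ring

/-- The error of a product of unitaries is at most the sum of the errors of its factors. -/
theorem norm_mul_prod_mul_sub_apply_le {n : ℕ} {ε : ℝ} : ∀ {T : ℕ} {a b : Fin T → UnitaryOp n},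
    (∀ t (L R : UnitaryOp n) x y, ‖((L * a t * R : UnitaryOp n) : Matrix (Bits n) (Bits n) ℂ) x y -
      ((L * b t * R : UnitaryOp n) : Matrix (Bits n) (Bits n) ℂ) x y‖ ≤ ε) →
    ∀ (L : UnitaryOp n) (x y : Bits n),
      ‖((L * (List.ofFn a).prod : UnitaryOp n) : Matrix (Bits n) (Bits n) ℂ) x y -
      ((L * (List.ofFn b).prod : UnitaryOp n) : Matrix (Bits n) (Bits n) ℂ) x y‖ ≤ T * ε
  | 0, _, _, _, L, x, y => by simp
  | T + 1, a, b, h, L, x, y => by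
    rw [List.ofFn_succ, List.ofFn_succ, List.prod_cons, List.prod_cons, ← mul_assoc, ← mul_assoc]
    have h1 := h 0 L (List.ofFn fun t : Fin T => a t.succ).prod x y
    have h2 := norm_mul_prod_mul_sub_apply_le (fun t => h t.succ) (L * b 0) x y
    refine (norm_sub_le_norm_sub_add_norm_sub _ _ _).trans ((add_le_add h1 h2).trans_eq ?_)
    push_cast
    ring

theorem norm_pauliString_le_one {n : ℕ} (P : Fin n → Fin 4) (x y : Bits n) :
    ‖pauliString P x y‖ ≤ 1 := by
  rw [pauliString, norm_prod]
  exact Finset.prod_le_one (fun _ _ => norm_nonneg _) fun i _ => norm_pauli_le_one _ _ _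

theorem norm_pauliCoeff_le {n : ℕ} (M : UnitaryOp n) (P : Fin n → Fin 4) :
    ‖pauliCoeff (M : Matrix (Bits n) (Bits n) ℂ) P‖ ≤ 4 ^ n := by
  refine (sum_sum_norm_le fun x y => ?_).trans_eq (mul_one _)
  rw [norm_mul]
  exact mul_le_one₀ (norm_unitaryOp_apply_le M x y) (norm_nonneg _) (norm_pauliString_le_one _ _ _)

theorem norm_pauliCoeff_sub_le {n : ℕ} {M M' : Matrix (Bits n) (Bits n) ℂ} {η : ℝ}
    (h : ∀ x y, ‖M x y - M' x y‖ ≤ η) (P : Fin n → Fin 4) :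
    ‖pauliCoeff M P - pauliCoeff M' P‖ ≤ 4 ^ n * η := by
  simp only [pauliCoeff, ← Finset.sum_sub_distrib, ← sub_mul]
  refine sum_sum_norm_le fun x y => ?_
  rw [norm_mul]
  exact (mul_le_of_le_one_right (norm_nonneg _) (norm_pauliString_le_one _ _ _)).trans (h x y)

theorem abs_overlapCoeff_sub_le {n : ℕ} {M M' : UnitaryOp n} {η : ℝ}
    (h : ∀ x y, ‖(M : Matrix (Bits n) (Bits n) ℂ) x y -
      (M' : Matrix (Bits n) (Bits n) ℂ) x y‖ ≤ η) (P Q : Fin n → Fin 4) :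
    |overlapCoeff (M : Matrix (Bits n) (Bits n) ℂ) P Q -
      overlapCoeff (M' : Matrix (Bits n) (Bits n) ℂ) P Q| ≤ 2 * 4 ^ n * η := by
  have hη : 0 ≤ η := (norm_nonneg _).trans (h 0 0)
  simp only [overlapCoeff]
  set p := pauliCoeff (M : Matrix (Bits n) (Bits n) ℂ) P
  set q := pauliCoeff (M : Matrix (Bits n) (Bits n) ℂ) Q
  set p' := pauliCoeff (M' : Matrix (Bits n) (Bits n) ℂ) P
  set q' := pauliCoeff (M' : Matrix (Bits n) (Bits n) ℂ) Q
  have hp : ‖p - p'‖ ≤ 4 ^ n * η := norm_pauliCoeff_sub_le h P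
  have hq : ‖q - q'‖ ≤ 4 ^ n * η := norm_pauliCoeff_sub_le h Q
  have hq1 : ‖q‖ ≤ 4 ^ n := norm_pauliCoeff_le M Q
  have hp1 : ‖p'‖ ≤ 4 ^ n := norm_pauliCoeff_le M' P
  have hz : p * star q - p' * star q' = (p - p') * star q + p' * star (q - q') := by
    rw [star_sub]; ring
  have hn : ‖p * star q - p' * star q'‖ ≤ 4 ^ n * (2 * 4 ^ n * η) := by
    rw [hz]
    refine (norm_add_le _ _).trans ?_
    rw [norm_mul, norm_mul, norm_star, norm_star]
    calc _ ≤ 4 ^ n * η * 4 ^ n + 4 ^ n * (4 ^ n * η) := by gcongr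
      _ = _ := by ring
  rw [← mul_sub, ← Complex.sub_re, abs_mul, abs_of_nonneg (by positivity : (0 : ℝ) ≤ (1 / 4) ^ n)]
  calc (1 / 4 : ℝ) ^ n * |(p * star q - p' * star q').re|
      ≤ (1 / 4) ^ n * (4 ^ n * (2 * 4 ^ n * η)) := by
        gcongr
        exact (Complex.abs_re_le_norm _).trans hn
    _ = 2 * 4 ^ n * η := by
        rw [← mul_assoc, ← mul_pow]
        norm_num

theorem deviation_overlap {n N : ℕ} (M : Matrix (Bits n) (Bits n) ℂ)
    (D : Fin N → Fin n → Fin 2 → ℂ) :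
    deviation (productLaw n) (overlap M) D = ∑ P, ∑ Q, overlapCoeff M P Q *
      deviation (productLaw n) (fun ψ => blochString P ψ * blochString Q ψ) D := by
  simp only [deviation, integral_overlap, mul_sub, Finset.sum_sub_distrib]
  congr 1
  simp only [overlap, normSq_expect_tensorVec]
  rw [Finset.sum_comm, Finset.mul_sum]
  refine Finset.sum_congr rfl fun P _ => ?_
  rw [Finset.sum_comm, Finset.mul_sum]
  refine Finset.sum_congr rfl fun Q _ => ?_
  rw [← Finset.mul_sum]
  ring

/-- The overlap is a linear combination of the `16 ^ n` functions `h_P h_Q`, so that their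
deviations control the deviation of a difference of overlaps. -/
theorem deviation_overlap_sub_le {n N : ℕ} {M M' : UnitaryOp n} {η τ : ℝ}
    (h : ∀ x y, ‖(M : Matrix (Bits n) (Bits n) ℂ) x y -
      (M' : Matrix (Bits n) (Bits n) ℂ) x y‖ ≤ η)
    {D : Fin N → Fin n → Fin 2 → ℂ}
    (hD : ∀ P Q : Fin n → Fin 4,
      |deviation (productLaw n) (fun ψ => blochString P ψ * blochString Q ψ) D| ≤ τ) :
    deviation (productLaw n) (overlap (M : Matrix (Bits n) (Bits n) ℂ)) D -
      deviation (productLaw n) (overlap (M' : Matrix (Bits n) (Bits n) ℂ)) D ≤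
      2 * 64 ^ n * η * τ := by
  have hη : 0 ≤ η := (norm_nonneg _).trans (h 0 0)
  simp only [deviation_overlap, ← Finset.sum_sub_distrib, ← sub_mul]
  calc _ ≤ ∑ P : Fin n → Fin 4, ∑ Q : Fin n → Fin 4, 2 * 4 ^ n * η * τ := by
        refine Finset.sum_le_sum fun P _ => Finset.sum_le_sum fun Q _ => ?_
        refine (le_abs_self _).trans ?_
        rw [abs_mul]
        exact mul_le_mul (abs_overlapCoeff_sub_le h P Q) (hD P Q) (abs_nonneg _) (by positivity)
    _ = 4 ^ n * 4 ^ n * 4 ^ n * 2 * η * τ := by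
        simp only [Finset.sum_const, Finset.card_univ, Fintype.card_fun, Fintype.card_fin,
          nsmul_eq_mul]
        push_cast
        ring
    _ = _ := by
        have h64 : (64 : ℝ) ^ n = 4 ^ n * 4 ^ n * 4 ^ n := by
          rw [← mul_pow, ← mul_pow]
          norm_num
        rw [h64]
        ring

theorem continuous_overlap {n : ℕ} (M : Matrix (Bits n) (Bits n) ℂ) : Continuous (overlap M) := by
  refine Complex.continuous_normSq.comp ((continuous_expect M).comp ?_)
  refine continuous_pi fun x => continuous_finsetProd _ fun i _ => ?_
  fun_prop

theorem overlap_le_one {n : ℕ} (M : UnitaryOp n) {ψ : Fin n → Fin 2 → ℂ}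
    (h : ∀ i, bloch (ψ i) 0 = 1) : overlap (M : Matrix (Bits n) (Bits n) ℂ) ψ ≤ 1 :=
  normSq_expect_le_one M (star_tensorVec_dotProduct h)

/-- Uniform convergence of the overlap over a family of unitaries that is sorted into finitely
many classes of entrywise diameter at most `η`. Hoeffding's inequality is applied to one
representative of each class and to the functions `± h_P h_Q`. -/
theorem le_measure_forall_deviation_overlap_le {n N : ℕ} (hN : 1 ≤ N) {A κ : Type*} [Fintype κ]
    (M : A → UnitaryOp n) (label : A → κ) {η : ℝ}
    (hlabel : ∀ α β, label α = label β → ∀ x y, ‖(M α : Matrix (Bits n) (Bits n) ℂ) x y -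
      (M β : Matrix (Bits n) (Bits n) ℂ) x y‖ ≤ η) {B δ : ℝ}
    (hδ : 0 < δ) (hδ1 : δ < 1) (hB : 1 ≤ B) (hcard : (Fintype.card κ + 2 * 16 ^ n : ℝ) ≤ B) :
    ENNReal.ofReal (1 - δ) ≤ (Measure.pi fun _ : Fin N => productLaw n)
      {D | ∀ α, deviation (productLaw n) (overlap (M α : Matrix (Bits n) (Bits n) ℂ)) D ≤
        (1 + 2 * 64 ^ n * η) * √(2 * Real.log (B / δ) / N)} := by
  classical
  -- A class that does not occur has no representative and is assigned the zero function.
  let f : κ ⊕ ((Fin n → Fin 4) × (Fin n → Fin 4)) × Bool → (Fin n → Fin 2 → ℂ) → ℝ :=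
    Sum.elim
      (fun l => if h : ∃ α, label α = l then
        overlap (M h.choose : Matrix (Bits n) (Bits n) ℂ) else fun _ => 0)
      (fun p ψ => (if p.2 then 1 else -1) * (blochString p.1.1 ψ * blochString p.1.2 ψ))
  have hf : ∀ l, Measurable (f l) := by
    rintro (l | p)
    · simp only [f, Sum.elim_inl]
      split_ifs with h
      exacts [(continuous_overlap _).measurable, measurable_const]
    · exact measurable_const.mul
        ((continuous_blochString _).mul (continuous_blochString _)).measurable
  have hb : ∀ l, ∀ᵐ ψ ∂productLaw n, |f l ψ| ≤ 1 := by
    rintro (l | p) <;> filter_upwards [ae_productLaw_bloch_zero n] with ψ hψ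
    · simp only [f, Sum.elim_inl]
      split_ifs with h
      · rw [overlap, abs_of_nonneg (Complex.normSq_nonneg _)]
        exact overlap_le_one _ hψ
      · simp
    · simp only [f, Sum.elim_inr, abs_mul]
      have h1 := abs_blochString_mul_le_one p.1.1 p.1.2 hψ
      rw [abs_mul] at h1
      split_ifs <;> simpa using h1
  have hc : (Fintype.card (κ ⊕ ((Fin n → Fin 4) × (Fin n → Fin 4)) × Bool) : ℝ) ≤ B := by
    refine le_trans (le_of_eq ?_) hcard
    simp only [Fintype.card_sum, Fintype.card_prod, Fintype.card_fun, Fintype.card_fin,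
      Fintype.card_bool]
    push_cast
    rw [← mul_pow]
    norm_num
    ring
  refine (le_measure_forall_deviation_le (productLaw n) hN hf hb hδ hδ1 hB hc).trans
    (measure_mono ?_)
  intro D hD α
  set τ := √(2 * Real.log (B / δ) / N)
  have hpq (P Q : Fin n → Fin 4) :
      |deviation (productLaw n) (fun ψ => blochString P ψ * blochString Q ψ) D| ≤ τ := by
    have h1 := hD (Sum.inr ((P, Q), true))
    have h2 := hD (Sum.inr ((P, Q), false))
    have hneg : deviation (productLaw n) (f (Sum.inr ((P, Q), false))) D =
        -deviation (productLaw n) (fun ψ => blochString P ψ * blochString Q ψ) D := by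
      simp only [deviation, f, Sum.elim_inr, Bool.false_eq_true, if_false, neg_mul, one_mul,
        integral_neg, Finset.sum_neg_distrib]
      ring
    have hpos : f (Sum.inr ((P, Q), true)) = fun ψ => blochString P ψ * blochString Q ψ := by
      funext ψ
      simp [f]
    rw [hneg] at h2
    rw [hpos] at h1
    exact abs_le.mpr ⟨by linarith, h1⟩
  have hex : ∃ β, label β = label α := ⟨α, rfl⟩
  have hrep := hD (Sum.inl (label α))
  have hfr : f (Sum.inl (label α)) = overlap (M hex.choose : Matrix (Bits n) (Bits n) ℂ) := by
    simp only [f, Sum.elim_inl]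
    exact dif_pos hex
  rw [hfr] at hrep
  have hsub := deviation_overlap_sub_le (hlabel α hex.choose hex.choose_spec.symm) hpq
  linarith

/-! ### Discretizing the gates -/

/-- The cell of a real number in the grid of mesh `2 / m` on `[-1, 1]`. -/
def gridIndex (m : ℕ) (x : ℝ) : Fin (m + 1) :=
  ⟨min m ⌊(x + 1) * m / 2⌋₊, by omega⟩

theorem abs_sub_le_of_gridIndex_eq {m : ℕ} (hm : 1 ≤ m) {x y : ℝ} (hx : |x| ≤ 1) (hy : |y| ≤ 1)
    (h : gridIndex m x = gridIndex m y) : |x - y| ≤ 2 / m := by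
  have hm0 : (0 : ℝ) < m := by positivity
  have key {z : ℝ} (hz : |z| ≤ 1) : ((gridIndex m z : ℕ) : ℝ) ≤ (z + 1) * m / 2 ∧
      (z + 1) * m / 2 ≤ (gridIndex m z : ℕ) + 1 := by
    obtain ⟨h1, h2⟩ := abs_le.mp hz
    have hnn : 0 ≤ (z + 1) * m / 2 := by
      have : 0 ≤ z + 1 := by linarith
      positivity
    have hle : (z + 1) * m / 2 ≤ m := by nlinarith
    have hfl : ⌊(z + 1) * m / 2⌋₊ ≤ m := Nat.floor_le_of_le hle
    have hval : (gridIndex m z : ℕ) = ⌊(z + 1) * m / 2⌋₊ := min_eq_right hfl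
    rw [hval]
    exact ⟨Nat.floor_le hnn, (Nat.lt_floor_add_one _).le⟩
  obtain ⟨h1, h2⟩ := key hx
  obtain ⟨h3, h4⟩ := key hy
  rw [h] at h1 h2
  rw [abs_le, neg_le, le_div_iff₀ hm0, le_div_iff₀ hm0]
  constructor <;> linarith

/-- The discretized description of a `k`-local gate: the set of qubits on which it acts, and the
grid cells of the real and imaginary parts of its matrix entries. -/
abbrev GateLabel (n k m : ℕ) : Type :=
  Σ s : {s : Finset (Fin n) // s.card ≤ k},
    (s.1 → Fin 2) → (s.1 → Fin 2) → Fin (m + 1) × Fin (m + 1)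

/-- The label of the gate `g` acting on the qubits in `s`. -/
def gateLabel {n k : ℕ} (m : ℕ)
    (p : Σ s : {s : Finset (Fin n) // s.card ≤ k}, Matrix.unitaryGroup (s.1 → Fin 2) ℂ) :
    GateLabel n k m :=
  ⟨p.1, fun a b => (gridIndex m ((p.2 : Matrix _ _ ℂ) a b).re,
    gridIndex m ((p.2 : Matrix _ _ ℂ) a b).im)⟩

theorem norm_sub_le_of_gridIndex_eq {m : ℕ} (hm : 1 ≤ m) {z w : ℂ} (hz : ‖z‖ ≤ 1) (hw : ‖w‖ ≤ 1)
    (hre : gridIndex m z.re = gridIndex m w.re) (him : gridIndex m z.im = gridIndex m w.im) :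
    ‖z - w‖ ≤ 4 / m := by
  have h1 := abs_sub_le_of_gridIndex_eq hm ((Complex.abs_re_le_norm _).trans hz)
    ((Complex.abs_re_le_norm _).trans hw) hre
  have h2 := abs_sub_le_of_gridIndex_eq hm ((Complex.abs_im_le_norm _).trans hz)
    ((Complex.abs_im_le_norm _).trans hw) him
  refine (Complex.norm_le_abs_re_add_abs_im _).trans ?_
  rw [Complex.sub_re, Complex.sub_im]
  calc _ ≤ (2 / m + 2 / m : ℝ) := add_le_add h1 h2
    _ = 4 / m := by ring

theorem norm_onQubits_sub_le_of_gateLabel_eq {n k m : ℕ} (hm : 1 ≤ m)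
    {p q : Σ s : {s : Finset (Fin n) // s.card ≤ k}, Matrix.unitaryGroup (s.1 → Fin 2) ℂ}
    (h : gateLabel m p = gateLabel m q) (x y : Bits n) :
    ‖onQubits p.1.1 p.2.1 x y - onQubits q.1.1 q.2.1 x y‖ ≤ 4 / m := by
  obtain ⟨s, g⟩ := p
  obtain ⟨s', g'⟩ := q
  obtain ⟨rfl, h2⟩ := Sigma.mk.inj h
  have h3 := eq_of_heq h2
  simp only [onQubits, of_apply]
  split_ifs with hxy
  · have hab := Prod.mk.inj (congrFun (congrFun h3 fun i => x i) fun i => y i)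
    exact norm_sub_le_of_gridIndex_eq hm (entry_norm_bound_of_unitary g.2 _ _)
      (entry_norm_bound_of_unitary g'.2 _ _) hab.1 hab.2
  · rw [sub_zero, norm_zero]
    positivity

theorem card_gateLabel_le (n k m : ℕ) :
    Fintype.card (GateLabel n k m) ≤ 2 ^ n * ((m + 1) ^ 2) ^ 4 ^ k := by
  rw [Fintype.card_sigma]
  calc _ ≤ ∑ _s : {s : Finset (Fin n) // s.card ≤ k}, ((m + 1) ^ 2) ^ 4 ^ k := by
        refine Finset.sum_le_sum fun s _ => ?_
        simp only [Fintype.card_fun, Fintype.card_prod, Fintype.card_fin, Fintype.card_coe]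
        rw [← pow_mul, ← mul_pow, ← pow_two]
        exact Nat.pow_le_pow_right (by positivity) (Nat.pow_le_pow_right (by norm_num) s.2)
    _ = Fintype.card {s : Finset (Fin n) // s.card ≤ k} * ((m + 1) ^ 2) ^ 4 ^ k := by simp
    _ ≤ _ := by
        refine Nat.mul_le_mul_right _ ((Fintype.card_subtype_le _).trans_eq ?_)
        simp

/-- Sorting the parameters by the labels of all `T` gates puts two parameters into the same class
only if the circuits agree up to the accumulated discretization error. -/
theorem QNN.exists_label {n k T : ℕ} {A : Type*} (V : QNN n k T A) {m : ℕ} (hm : 1 ≤ m)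
    (U : UnitaryOp n) :
    ∃ label : A → (Fin T → GateLabel n k m), ∀ α β, label α = label β → ∀ x y,
      ‖((U⁻¹ * V.unitary α : UnitaryOp n) : Matrix (Bits n) (Bits n) ℂ) x y -
        ((U⁻¹ * V.unitary β : UnitaryOp n) : Matrix (Bits n) (Bits n) ℂ) x y‖ ≤
      T * (4 ^ n * (4 / m)) := by
  choose s g hs hg using V.gate_local
  refine ⟨fun α t => gateLabel m ⟨⟨s t α, hs t α⟩, g t α⟩, fun α β h x y => ?_⟩
  rw [QNN.unitary, QNN.unitary, ← mul_assoc, ← mul_assoc]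
  refine norm_mul_prod_mul_sub_apply_le (fun t L R x y => ?_) _ x y
  rw [← mul_assoc L, ← mul_assoc L, mul_assoc (L * _), mul_assoc (L * _)]
  refine norm_mul_mul_sub_apply_le (fun x y => ?_) L _ x y
  rw [hg, hg]
  exact norm_onQubits_sub_le_of_gateLabel_eq hm (congrFun h t) x y

/-- The mesh `m = 8 T 256ⁿ` makes the discretization error negligible, and the logarithm of the
number of labels is still only of order `n T log T`. -/
theorem card_label_add_le {n T : ℕ} (k : ℕ) (hn : 1 ≤ n) (hT : 2 ≤ T) :
    (Fintype.card (Fin T → GateLabel n k (8 * T * 256 ^ n)) + 2 * 16 ^ n : ℝ) ≤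
      Real.exp (28 * 4 ^ k * (n * (T * Real.log T))) := by
  set m := 8 * T * 256 ^ n with hm
  have hn1 : (1 : ℝ) ≤ n := by exact_mod_cast hn
  have hT2 : (2 : ℝ) ≤ T := by exact_mod_cast hT
  set l := Real.log T with hl
  have hl2 : Real.log 2 ≤ l := Real.log_le_log (by norm_num) hT2
  have hlog2 : 0 < Real.log 2 := Real.log_pos (by norm_num)
  have hl0 : 0 < l := hlog2.trans_le hl2
  have h2 : (2 : ℝ) ≤ Real.exp l := by
    rw [hl, Real.exp_log (by linarith)]; exact hT2
  have hnl : l ≤ n * l := le_mul_of_one_le_left hl0.le hn1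
  have hk : (1 : ℝ) ≤ 4 ^ k := one_le_pow₀ (by norm_num)
  have hmle : ((m + 1 : ℕ) : ℝ) ≤ Real.exp (13 * (n * l)) := by
    have h16 : ((m + 1 : ℕ) : ℝ) ≤ 2 ^ 4 * T * (2 ^ 8) ^ n := by
      have : 1 ≤ m := Nat.one_le_iff_ne_zero.mpr (by positivity)
      have h' : m + 1 ≤ 16 * T * 256 ^ n := by
        calc m + 1 ≤ m + m := by omega
          _ = _ := by rw [hm]; ring
      calc ((m + 1 : ℕ) : ℝ) ≤ ((16 * T * 256 ^ n : ℕ) : ℝ) := by exact_mod_cast h'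
        _ = _ := by push_cast; norm_num
    calc _ ≤ 2 ^ 4 * (T : ℝ) * (2 ^ 8) ^ n := h16
      _ ≤ Real.exp l ^ 4 * Real.exp l * (Real.exp l ^ 8) ^ n := by
          gcongr
          rw [hl, Real.exp_log (by linarith)]
      _ = Real.exp (4 * l + l + 8 * (n * l)) := by
          rw [Real.exp_add, Real.exp_add, ← Real.exp_nat_mul, ← Real.exp_nat_mul,
            ← Real.exp_nat_mul]
          push_cast
          ring_nf
      _ ≤ _ := Real.exp_le_exp.mpr (by linarith)
  have hgate : (Fintype.card (GateLabel n k m) : ℝ) ≤ Real.exp (27 * 4 ^ k * (n * l)) := by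
    calc (Fintype.card (GateLabel n k m) : ℝ) ≤ ((2 ^ n * ((m + 1) ^ 2) ^ 4 ^ k : ℕ) : ℝ) := by
          exact_mod_cast card_gateLabel_le n k m
      _ = 2 ^ n * (((m + 1 : ℕ) : ℝ) ^ 2) ^ 4 ^ k := by push_cast; ring
      _ ≤ Real.exp l ^ n * (Real.exp (13 * (n * l)) ^ 2) ^ 4 ^ k := by gcongr
      _ = Real.exp (n * l + 4 ^ k * (26 * (n * l))) := by
          rw [Real.exp_add, ← Real.exp_nat_mul, ← Real.exp_nat_mul, ← Real.exp_nat_mul]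
          push_cast
          ring_nf
      _ ≤ _ := Real.exp_le_exp.mpr (by nlinarith)
  have hX : l ≤ 4 ^ k * (n * (T * l)) := by
    have h1 : 1 * l ≤ T * l := by gcongr; linarith
    have h3 : 1 * (T * l) ≤ n * (T * l) := by gcongr
    have h4 : 1 * (n * (T * l)) ≤ 4 ^ k * (n * (T * l)) := by gcongr
    linarith
  have hlabels : (Fintype.card (Fin T → GateLabel n k m) : ℝ) ≤
      Real.exp (27 * (4 ^ k * (n * (T * l)))) := by
    rw [Fintype.card_fun, Fintype.card_fin]
    push_cast
    calc _ ≤ Real.exp (27 * 4 ^ k * (n * l)) ^ T := by gcongr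
      _ = _ := by rw [← Real.exp_nat_mul]; ring_nf
  have hpauli : (2 * 16 ^ n : ℝ) ≤ Real.exp (27 * (4 ^ k * (n * (T * l)))) := by
    calc (2 * 16 ^ n : ℝ) = 2 * (2 ^ 4) ^ n := by norm_num
      _ ≤ Real.exp l * (Real.exp l ^ 4) ^ n := by gcongr
      _ = Real.exp (l + 4 * (n * l)) := by
          rw [Real.exp_add, ← Real.exp_nat_mul, ← Real.exp_nat_mul]
          push_cast
          ring_nf
      _ ≤ _ := by
          refine Real.exp_le_exp.mpr ?_
          have h1 : 1 * (n * l) ≤ T * (n * l) := by gcongr; linarith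
          have h3 : 1 * (T * (n * l)) ≤ 4 ^ k * (T * (n * l)) := by gcongr
          have h4 : 4 ^ k * (T * (n * l)) = 4 ^ k * (n * (T * l)) := by ring
          linarith
  calc _ ≤ Real.exp (27 * (4 ^ k * (n * (T * l)))) + Real.exp (27 * (4 ^ k * (n * (T * l)))) :=
        add_le_add hlabels hpauli
    _ = 2 * Real.exp (27 * (4 ^ k * (n * (T * l)))) := by ring
    _ ≤ Real.exp l * Real.exp (27 * (4 ^ k * (n * (T * l)))) := by gcongr
    _ = Real.exp (l + 27 * (4 ^ k * (n * (T * l)))) := (Real.exp_add _ _).symm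
    _ ≤ _ := Real.exp_le_exp.mpr (by linarith)

/-! ### Out-of-distribution generalization -/

theorem sqrt_log_div_le {n T N k : ℕ} (hn : 1 ≤ n) (hT : 2 ≤ T) {δ : ℝ} (hδ : 0 < δ)
    (hδ1 : δ < 1) :
    √(2 * Real.log (Real.exp (28 * 4 ^ k * (n * (T * Real.log T))) / δ) / N) ≤
      8 * 2 ^ k * (n * √(T * Real.log T / N) + √(Real.log (1 / δ) / N)) := by
  have hn1 : (1 : ℝ) ≤ n := by exact_mod_cast hn
  have hT2 : (2 : ℝ) ≤ T := by exact_mod_cast hT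
  have hl0 : 0 ≤ Real.log T := Real.log_nonneg (by linarith)
  have hd0 : 0 ≤ Real.log (1 / δ) := Real.log_nonneg (by rw [le_div_iff₀ hδ]; linarith)
  have hk : (1 : ℝ) ≤ 2 ^ k := one_le_pow₀ (by norm_num)
  have h4 : (4 : ℝ) ^ k = 2 ^ k * 2 ^ k := by rw [← mul_pow]; norm_num
  set a := T * Real.log T / N with ha
  set b := Real.log (1 / δ) / N with hb
  have ha0 : 0 ≤ a := by positivity
  have hb0 : 0 ≤ b := by positivity
  have hlog : 2 * Real.log (Real.exp (28 * 4 ^ k * (n * (T * Real.log T))) / δ) / N =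
      56 * 4 ^ k * n * a + 2 * b := by
    rw [Real.log_div (Real.exp_ne_zero _) hδ.ne', Real.log_exp, ha, hb, one_div, Real.log_inv]
    ring
  rw [hlog]
  have hadd : √(56 * 4 ^ k * n * a + 2 * b) ≤ √(56 * 4 ^ k * n * a) + √(2 * b) := by
    have e1 := Real.sq_sqrt (by positivity : 0 ≤ 56 * 4 ^ k * n * a)
    have e2 := Real.sq_sqrt (by positivity : 0 ≤ 2 * b)
    have e3 : 0 ≤ √(56 * 4 ^ k * n * a) * √(2 * b) := by positivity
    exact Real.sqrt_le_iff.mpr ⟨by positivity, by nlinarith⟩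
  refine hadd.trans ?_
  have h1 : √(56 * 4 ^ k * n * a) ≤ 8 * 2 ^ k * n * √a := by
    rw [← Real.sqrt_sq (by positivity : (0 : ℝ) ≤ 8 * 2 ^ k * n), ← Real.sqrt_mul (by positivity)]
    refine Real.sqrt_le_sqrt (mul_le_mul_of_nonneg_right ?_ ha0)
    calc (56 * 4 ^ k * n : ℝ) ≤ 64 * 4 ^ k * (n * n) := by
          gcongr
          · norm_num
          · exact le_mul_of_one_le_left (by linarith) hn1
      _ = _ := by rw [h4]; ring
  have h2 : √(2 * b) ≤ 8 * 2 ^ k * √b := by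
    rw [← Real.sqrt_sq (by positivity : (0 : ℝ) ≤ 8 * 2 ^ k), ← Real.sqrt_mul (by positivity)]
    exact Real.sqrt_le_sqrt (mul_le_mul_of_nonneg_right (by nlinarith) hb0)
  linarith

end QubitLearning

end

theorem corollary3 (k : ℕ) :
    ∃ C : ℝ, 0 < C ∧
      ∀ (n T N : ℕ), 1 ≤ n → 2 ≤ T → 1 ≤ N →
      ∀ (δ : ℝ), 0 < δ → δ < 1 →
      ∀ (P : Measure (Bits n → ℂ)), IsLocallyScrambledStatesTwo P →
      ∀ (U : UnitaryOp n) (A : Type*) (V : QNN n k T A),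
        ENNReal.ofReal (1 - δ) ≤
          productDataLaw n N {D | ∀ α : A,
            risk P U (V.unitary α) ≤
              2 * n * localCost D U (V.unitary α) +
                C * (n * Real.sqrt (T * Real.log T / N) +
                  Real.sqrt (Real.log (1 / δ) / N))} := by
  refine ⟨32 * 2 ^ k, by positivity, ?_⟩
  intro n T N hn hT hN δ hδ hδ1 P hP U A V
  set m := 8 * T * 256 ^ n with hm
  have hm1 : 1 ≤ m := Nat.one_le_iff_ne_zero.mpr (by positivity)
  obtain ⟨label, hlabel⟩ := V.exists_label hm1 U
  have hT0 : (T : ℝ) ≠ 0 := by positivity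
  -- At this mesh the discretization at most doubles the deviation.
  have hη : 2 * 64 ^ n * (T * (4 ^ n * (4 / m))) = (1 : ℝ) := by
    have h256 : (256 : ℝ) ^ n = 64 ^ n * 4 ^ n := by rw [← mul_pow]; norm_num
    rw [hm]
    push_cast
    rw [h256]
    field_simp
    norm_num
  have hB : (1 : ℝ) ≤ Real.exp (28 * 4 ^ k * (n * (T * Real.log T))) :=
    Real.one_le_exp (by positivity)
  refine (le_measure_forall_deviation_overlap_le hN (fun α => U⁻¹ * V.unitary α) label hlabel
    hδ hδ1 hB (card_label_add_le k hn hT)).trans ?_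
  -- The sample is almost surely normalized, which is needed to compare the global and local costs.
  have hae : ∀ᵐ D ∂productDataLaw n N, ∀ j i, bloch (D j i) 0 = 1 := by
    rw [ae_all_iff]
    intro j
    exact (Measure.quasiMeasurePreserving_eval (fun _ : Fin N => productLaw n) j).ae
      (ae_productLaw_bloch_zero n)
  refine measure_mono_ae ?_
  filter_upwards [hae] with D hD hdev α
  have h1 := hdev α
  rw [hη] at h1
  have h2 := sqrt_log_div_le (N := N) (k := k) hn hT hδ hδ1
  have h3 := risk_le_two_mul_integral hP U (V.unitary α)
  have h4 := mean_one_sub_overlap_le hn hN hD U (V.unitary α)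
  rw [deviation] at h1
  linarith
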